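/- Let $n\ge 3$ and let $U\subseteq\mathbb{R}^n$ be open. Let $\alpha=\sqrt{a_{ij}(x)y^iy^j}$ be a smooth Riemannian metric and $\beta=b_i(x)y^i$ a smooth 1-form on $U$; let $0<b_0\le\infty$ and let $\phi$ be a positive smooth function on $(-b_0,b_0)$ with $$\phi(s)-s\phi'(s)+(r^2-s^2)\phi''(s)>0\qquad\text{whenever } |s|\le r<b_0 ,$$ and suppose that $\|\beta\|_\alpha=\sqrt{a^{ij}b_ib_j}<b_0$ at every point of $U$. Let $F=\alpha\,\phi(\beta/\alpha)$ be the corresponding Finsler metric (continuous, nonnegative, smooth for $y\ne0$, positively homogeneous of degree one in $y$, with positive definite fundamental tensor $g_{ij}=[\tfrac12F^2]_{y^iy^j}$ for $y\neq 0$); Finsler metrics of this form are called $(\alpha,\beta)$-metrics. A Finsler metric on $U$ is called projectively flat if all its geodesics, i.e. the regular curves $c$ in $U$ with $\ddot c^i+2G^i(c,\dot c)=0$, $G^i=\tfrac14g^{il}\{[F^2]_{x^ky^l}y^k-[F^2]_{x^l}\}$, lie on straight lines of $\mathbb{R}^n$, and reversible if $F(x,\lambda y)=|\lambda|F(x,y)$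 for all $\lambda\in\mathbb{R}$. Suppose that $F$ is projectively flat on $U$ and non-trivial, in the sense that there is no connected component of $U$ on which $\alpha$ is projectively flat and $\beta$ is parallel with respect to $\alpha$. Then the 1-form $\theta=-\phi'(0)\beta$ is closed on $U$, and $F+\theta$ is a reversible projectively flat $(\alpha,\beta)$-metric on $U$ (that is, $F+\theta=\bar\alpha\,\bar\phi(\bar\beta/\bar\alpha)$ for some data $\bar\alpha,\bar\beta,\bar\phi,\bar b_0$ as above). -/

import Mathlib

open scoped ContDiff Matrix

namespace Finsler

noncomputable section

/-- Coordinates of points and of tangent vectors of `ℝⁿ`. Only the linear structure and the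
topology of this space are used below, never its norm. -/
abbrev Vec (n : ℕ) := Fin n → ℝ

/-- The partial derivative `∂f/∂xᵏ` at `x`. -/
def pderiv {n : ℕ} (k : Fin n) (f : Vec n → ℝ) (x : Vec n) : ℝ :=
  fderiv ℝ f x (Pi.single k 1)

/-- The partial derivative `F_{xᵏ}` of a function `F(x, y)`. -/
def derivX {n : ℕ} (k : Fin n) (F : Vec n → Vec n → ℝ) (x y : Vec n) : ℝ :=
  pderiv k (fun z => F z y) x

/-- The partial derivative `F_{yᵏ}` of a function `F(x, y)`. -/
def derivY {n : ℕ} (k : Fin n) (F : Vec n → Vec n → ℝ) (x y : Vec n) : ℝ :=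
  pderiv k (fun z => F x z) y

/-- The function `F²`. -/
def sqr {n : ℕ} (F : Vec n → Vec n → ℝ) (x y : Vec n) : ℝ := F x y ^ 2

/-- The fundamental tensor `g_{ij} = [F² / 2]_{yⁱ yʲ}`. -/
def fundTensor {n : ℕ} (F : Vec n → Vec n → ℝ) (x y : Vec n) : Matrix (Fin n) (Fin n) ℝ :=
  Matrix.of fun i j => (1 / 2) * derivY j (derivY i (sqr F)) x y

/-- `F` is a Finsler metric on `U` (only the values `F x y` with `x ∈ U` matter). -/
structure IsFinslerMetric {n : ℕ} (U : Set (Vec n)) (F : Vec n → Vec n → ℝ) : Prop where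
  continuousOn : ContinuousOn (fun p : Vec n × Vec n => F p.1 p.2) (U ×ˢ Set.univ)
  nonneg : ∀ x ∈ U, ∀ y, 0 ≤ F x y
  smooth : ContDiffOn ℝ ∞ (fun p : Vec n × Vec n => F p.1 p.2) (U ×ˢ {y | y ≠ 0})
  homogeneous : ∀ x ∈ U, ∀ y, ∀ c : ℝ, 0 < c → F x (c • y) = c * F x y
  stronglyConvex : ∀ x ∈ U, ∀ y, y ≠ 0 → (fundTensor F x y).PosDef

/-- `F` is absolutely homogeneous: `F(x, c y) = |c| F(x, y)` for all real `c`. -/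
def IsReversible {n : ℕ} (U : Set (Vec n)) (F : Vec n → Vec n → ℝ) : Prop :=
  ∀ x ∈ U, ∀ y, ∀ c : ℝ, F x (c • y) = |c| * F x y

/-- The spray coefficients `Gⁱ = (1/4) gⁱˡ ([F²]_{xᵏ yˡ} yᵏ - [F²]_{xˡ})`. -/
def spray {n : ℕ} (F : Vec n → Vec n → ℝ) (x y : Vec n) : Vec n := fun i =>
  (1 / 4) * ∑ l, (fundTensor F x y)⁻¹ i l *
    ((∑ k, derivY l (derivX k (sqr F)) x y * y k) - derivX l (sqr F) x y)

/-- `c : (t₀, t₁) → U` is a geodesic of `F`: a regular curve with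
`c̈ⁱ + 2 Gⁱ(c, ċ) = 0`; here `v` is the velocity `ċ`. -/
def IsGeodesic {n : ℕ} (U : Set (Vec n)) (F : Vec n → Vec n → ℝ) (t₀ t₁ : ℝ)
    (c : ℝ → Vec n) : Prop :=
  ∃ v : ℝ → Vec n, ∀ t ∈ Set.Ioo t₀ t₁, c t ∈ U ∧ v t ≠ 0 ∧ HasDerivAt c (v t) t ∧
    HasDerivAt v (-(2 : ℝ) • spray F (c t) (v t)) t

/-- `F` is projectively flat on `U`: as a point set, every geodesic of `F` in `U` lies on a
straight line of `ℝⁿ`. -/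
def IsProjectivelyFlat {n : ℕ} (U : Set (Vec n)) (F : Vec n → Vec n → ℝ) : Prop :=
  ∀ (t₀ t₁ : ℝ) (c : ℝ → Vec n), IsGeodesic U F t₀ t₁ c →
    ∃ p d : Vec n, d ≠ 0 ∧ ∀ t ∈ Set.Ioo t₀ t₁, ∃ r : ℝ, c t = p + r • d

/-- `a = (a_{ij}(x))` is a (smooth) Riemannian metric on `U`. -/
def IsRiemannianMetric {n : ℕ} (U : Set (Vec n)) (a : Vec n → Matrix (Fin n) (Fin n) ℝ) : Prop :=
  (∀ i j, ContDiffOn ℝ ∞ (fun x => a x i j) U) ∧ ∀ x ∈ U, (a x).PosDef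

/-- `b = (b_i(x))` is a (smooth) `1`-form on `U`. -/
def IsOneForm {n : ℕ} (U : Set (Vec n)) (b : Vec n → Vec n) : Prop :=
  ∀ i, ContDiffOn ℝ ∞ (fun x => b x i) U

/-- The `1`-form `b` is closed on `U`. -/
def IsClosedForm {n : ℕ} (U : Set (Vec n)) (b : Vec n → Vec n) : Prop :=
  ∀ x ∈ U, ∀ i j, pderiv j (fun z => b z i) x = pderiv i (fun z => b z j) x

/-- `α(x, y) = √(a_{ij}(x) yⁱ yʲ)`. -/
def alpha {n : ℕ} (a : Vec n → Matrix (Fin n) (Fin n) ℝ) (x y : Vec n) : ℝ :=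
  Real.sqrt (y ⬝ᵥ (a x *ᵥ y))

/-- `β(x, y) = b_i(x) yⁱ`. -/
def beta {n : ℕ} (b : Vec n → Vec n) (x y : Vec n) : ℝ := b x ⬝ᵥ y

/-- The norm `√(aⁱʲ(x) b_i(x) b_j(x))` of the `1`-form `b` with respect to `a` at `x`. -/
def formNorm {n : ℕ} (a : Vec n → Matrix (Fin n) (Fin n) ℝ) (b : Vec n → Vec n) (x : Vec n) : ℝ :=
  Real.sqrt (b x ⬝ᵥ ((a x)⁻¹ *ᵥ b x))

/-- The Christoffel symbols `Γᵏ_{ij}` of `a`. -/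
def christoffel {n : ℕ} (a : Vec n → Matrix (Fin n) (Fin n) ℝ) (k i j : Fin n) (x : Vec n) : ℝ :=
  (1 / 2) * ∑ l, (a x)⁻¹ k l * (pderiv i (fun z => a z l j) x + pderiv j (fun z => a z l i) x
    - pderiv l (fun z => a z i j) x)

/-- The covariant derivative `b_{i|j}` of the `1`-form `b` with respect to `a`. -/
def covDeriv {n : ℕ} (a : Vec n → Matrix (Fin n) (Fin n) ℝ) (b : Vec n → Vec n) (i j : Fin n)
    (x : Vec n) : ℝ :=
  pderiv j (fun z => b z i) x - ∑ k, b x k * christoffel a k i j x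

/-- The `1`-form `b` is parallel with respect to `a` on `U`. -/
def IsParallel {n : ℕ} (U : Set (Vec n)) (a : Vec n → Matrix (Fin n) (Fin n) ℝ)
    (b : Vec n → Vec n) : Prop :=
  ∀ x ∈ U, ∀ i j, covDeriv a b i j x = 0

/-- The function `α φ(β / α)`; its value at `y = 0` is `0`. -/
def alphaBeta {n : ℕ} (a : Vec n → Matrix (Fin n) (Fin n) ℝ) (b : Vec n → Vec n) (φ : ℝ → ℝ)
    (x y : Vec n) : ℝ :=
  alpha a x y * φ (beta b x y / alpha a x y)

/-- `φ` is a positive smooth function on `(-b₀, b₀)`, where `0 < b₀ ≤ ∞`, and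
`φ(s) - s φ'(s) + (r² - s²) φ''(s) > 0` whenever `|s| ≤ r < b₀`. -/
structure IsAdmissible (b₀ : EReal) (φ : ℝ → ℝ) : Prop where
  pos_bound : 0 < b₀
  smooth : ContDiffOn ℝ ∞ φ {s : ℝ | ((|s| : ℝ) : EReal) < b₀}
  pos : ∀ s : ℝ, ((|s| : ℝ) : EReal) < b₀ → 0 < φ s
  regular : ∀ s r : ℝ, |s| ≤ r → (r : EReal) < b₀ →
    0 < φ s - s * deriv φ s + (r ^ 2 - s ^ 2) * deriv (deriv φ) s

/-- `F` is the `(α, β)`-metric `α φ(β / α)` on `U`, with `φ` defined on `(-b₀, b₀)`. -/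
structure IsAlphaBetaData {n : ℕ} (U : Set (Vec n)) (a : Vec n → Matrix (Fin n) (Fin n) ℝ)
    (b : Vec n → Vec n) (b₀ : EReal) (φ : ℝ → ℝ) (F : Vec n → Vec n → ℝ) : Prop where
  riemannian : IsRiemannianMetric U a
  oneForm : IsOneForm U b
  admissible : IsAdmissible b₀ φ
  norm_lt : ∀ x ∈ U, (formNorm a b x : EReal) < b₀
  eq : ∀ x ∈ U, ∀ y, F x y = alphaBeta a b φ x y
  finsler : IsFinslerMetric U F

/-- `F` is an `(α, β)`-metric on `U`. -/
def IsAlphaBetaMetric {n : ℕ} (U : Set (Vec n)) (F : Vec n → Vec n → ℝ) : Prop :=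
  ∃ (a : Vec n → Matrix (Fin n) (Fin n) ℝ) (b : Vec n → Vec n) (b₀ : EReal) (φ : ℝ → ℝ),
    IsAlphaBetaData U a b b₀ φ F

/-- The trivial case on `U`: `α` is projectively flat and `β` is parallel with respect to `α`. -/
def IsTrivialPair {n : ℕ} (U : Set (Vec n)) (a : Vec n → Matrix (Fin n) (Fin n) ℝ)
    (b : Vec n → Vec n) : Prop :=
  IsProjectivelyFlat U (alpha a) ∧ IsParallel U a b

/-- Non-triviality: the trivial case occurs on no connected component of `U`. -/
def IsNontrivialPair {n : ℕ} (U : Set (Vec n)) (a : Vec n → Matrix (Fin n) (Fin n) ℝ)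
    (b : Vec n → Vec n) : Prop :=
  ∀ x ∈ U, ¬ IsTrivialPair (connectedComponentIn U x) a b

end

end Finsler

namespace Finsler

variable {n : ℕ}

/-! Calculus of partial derivatives. -/

/-! The proof rests on Hamel's criterion: `F` is projectively flat exactly when the vector `hamel
F`, with components `F_{xᵏ yˡ} yᵏ - F_{xˡ}`, vanishes for `y ≠ 0` (`isProjectivelyFlat_of_hamel`,
`hamel_eq_zero_of_isProjectivelyFlat`). Unlike the geodesic equation, this condition is linear in
`F`.

Write `s = β/α`. By `hamel_alphaBeta`, the Hamel vector of `α f(s)` is `(f - s f') A + f' M y + f''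
T S`, where `A` is the Hamel vector of `α`, `M` the curl of `β`, `T` is `α` times the derivative of
`s` along the flow `yᵏ ∂/∂xᵏ`, and `S` is the `y`-gradient of `s`. Comparing the equations at `y`
and `-y` shows that they hold separately for the even part `g` and the odd part `h` of `φ`
(`hamel_reflComb`).

The key point is that `h` is linear on the range of `s`. Suppose `h(r) ≠ h'(0) r` for some `r > 0`.
At every point with `‖β‖ > r` the two systems are then independent, because two Wronskians are
nonzero somewhere, and this forces `M`, `T` and `A` to vanish (`coefficients_eq_zero`, `rigidity`).
There `α` satisfies Hamel's equations and `β` is parallel (`covDeriv_eq_zero`), so `‖β‖` is locally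
constant. Hence `‖β‖ > r` persists on a whole component (`normSq_eq_on_component`), which is the
excluded trivial case.

Thus `h(s) = φ'(0) s` and `F + θ = α g(β/α)` (`oddPart_eq`). This metric is reversible, satisfies
Hamel's equations, and is the average of `F(x, y)` and `F(x, -y)`, hence strongly convex. Finally,
the Hamel vector of `θ` is that of `F + θ` minus that of `F`, so it is zero, and it equals the curl
of `θ` applied to `y`: `θ` is closed. -/

theorem _root_.HasFDerivAt.pderiv_eq {k : Fin n} {f : Vec n → ℝ} {x : Vec n} {f' : Vec n →L[ℝ] ℝ}
    (h : HasFDerivAt f f' x) : pderiv k f x = f' (Pi.single k 1) := by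
  rw [pderiv, h.fderiv]

theorem sum_apply_single_mul (L : Vec n →L[ℝ] ℝ) (y : Vec n) :
    ∑ k, L (Pi.single k 1) * y k = L y := by
  conv_rhs => rw [pi_eq_sum_univ' y]
  rw [map_sum]
  refine Finset.sum_congr rfl fun k _ => ?_
  rw [map_smul, smul_eq_mul, mul_comm]

theorem sum_pderiv_mul (f : Vec n → ℝ) (x y : Vec n) :
    ∑ k, pderiv k f x * y k = fderiv ℝ f x y := sum_apply_single_mul _ _

theorem pderiv_congr {k : Fin n} {f g : Vec n → ℝ} {x : Vec n} (h : f =ᶠ[nhds x] g) :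
    pderiv k f x = pderiv k g x := by
  rw [pderiv, pderiv, h.fderiv_eq]

theorem pderiv_const (k : Fin n) (c : ℝ) (x : Vec n) : pderiv k (fun _ => c) x = 0 := by
  simp [pderiv]

theorem pderiv_add {k : Fin n} {f g : Vec n → ℝ} {x : Vec n} (hf : DifferentiableAt ℝ f x)
    (hg : DifferentiableAt ℝ g x) :
    pderiv k (fun z => f z + g z) x = pderiv k f x + pderiv k g x :=
  (hf.hasFDerivAt.add hg.hasFDerivAt).pderiv_eq

theorem pderiv_sub {k : Fin n} {f g : Vec n → ℝ} {x : Vec n} (hf : DifferentiableAt ℝ f x)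
    (hg : DifferentiableAt ℝ g x) :
    pderiv k (fun z => f z - g z) x = pderiv k f x - pderiv k g x :=
  (hf.hasFDerivAt.sub hg.hasFDerivAt).pderiv_eq

theorem pderiv_mul {k : Fin n} {f g : Vec n → ℝ} {x : Vec n} (hf : DifferentiableAt ℝ f x)
    (hg : DifferentiableAt ℝ g x) :
    pderiv k (fun z => f z * g z) x = f x * pderiv k g x + g x * pderiv k f x :=
  (hf.hasFDerivAt.mul hg.hasFDerivAt).pderiv_eq

theorem pderiv_const_mul (k : Fin n) (c : ℝ) (f : Vec n → ℝ) (x : Vec n) :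
    pderiv k (fun z => c * f z) x = c * pderiv k f x := by
  have : fderiv ℝ (fun z => c * f z) x = c • fderiv ℝ f x :=
    congrFun (fderiv_const_smul_field c (f := f)) x
  rw [pderiv, this]; rfl

theorem pderiv_neg (k : Fin n) (f : Vec n → ℝ) (x : Vec n) :
    pderiv k (fun z => -f z) x = -pderiv k f x := by
  rw [pderiv, fderiv_fun_neg]; rfl

theorem pderiv_sum {ι : Type*} {s : Finset ι} {k : Fin n} {f : ι → Vec n → ℝ} {x : Vec n}
    (hf : ∀ i ∈ s, DifferentiableAt ℝ (f i) x) :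
    pderiv k (fun z => ∑ i ∈ s, f i z) x = ∑ i ∈ s, pderiv k (f i) x := by
  rw [(HasFDerivAt.fun_sum fun i hi => (hf i hi).hasFDerivAt).pderiv_eq,
    sum_apply]
  rfl

theorem pderiv_comp {k : Fin n} {g : ℝ → ℝ} {f : Vec n → ℝ} {x : Vec n}
    (hg : DifferentiableAt ℝ g (f x)) (hf : DifferentiableAt ℝ f x) :
    pderiv k (fun z => g (f z)) x = deriv g (f x) * pderiv k f x :=
  (hg.hasDerivAt.comp_hasFDerivAt x hf.hasFDerivAt).pderiv_eq

theorem pderiv_comp_smul (k : Fin n) (c : ℝ) (f : Vec n → ℝ) (x : Vec n) :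
    pderiv k (fun z => f (c • z)) x = c * pderiv k f (c • x) := by
  have : fderiv ℝ (fun z => f (c • z)) x = c • fderiv ℝ f (c • x) := fderiv_comp_smul c
  rw [pderiv, this]; rfl

theorem pderiv_comp_neg (k : Fin n) (f : Vec n → ℝ) (x : Vec n) :
    pderiv k (fun z => f (-z)) x = -pderiv k f (-x) := by
  simpa using pderiv_comp_smul k (-1) f x

theorem pderiv_apply (k i : Fin n) (x : Vec n) :
    pderiv k (fun z => z i) x = if i = k then 1 else 0 := by
  rw [(hasFDerivAt_apply (𝕜 := ℝ) i x).pderiv_eq]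
  simp [Pi.single_apply]

/-! Functions `F(x, y)` that are smooth on a subset of `ℝⁿ × ℝⁿ`. -/

/-- `F(x, y)` is smooth on `W`. -/
def SmoothOn (W : Set (Vec n × Vec n)) (F : Vec n → Vec n → ℝ) : Prop :=
  ContDiffOn ℝ ∞ (fun p : Vec n × Vec n => F p.1 p.2) W

variable {W : Set (Vec n × Vec n)} {F G : Vec n → Vec n → ℝ}

theorem SmoothOn.contDiffAt (hF : SmoothOn W F) (hW : IsOpen W) {x y : Vec n} (h : (x, y) ∈ W) :
    ContDiffAt ℝ ∞ (fun p : Vec n × Vec n => F p.1 p.2) (x, y) :=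
  ContDiffOn.contDiffAt hF (hW.mem_nhds h)

theorem SmoothOn.differentiableAt (hF : SmoothOn W F) (hW : IsOpen W) {x y : Vec n}
    (h : (x, y) ∈ W) : DifferentiableAt ℝ (fun p : Vec n × Vec n => F p.1 p.2) (x, y) :=
  (hF.contDiffAt hW h).differentiableAt (by simp)

theorem SmoothOn.contDiffAt_left (hF : SmoothOn W F) (hW : IsOpen W) {x y : Vec n}
    (h : (x, y) ∈ W) : ContDiffAt ℝ ∞ (fun z => F z y) x :=
  (hF.contDiffAt hW h).comp x (f := fun z => (z, y)) (by fun_prop)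

theorem SmoothOn.contDiffAt_right (hF : SmoothOn W F) (hW : IsOpen W) {x y : Vec n}
    (h : (x, y) ∈ W) : ContDiffAt ℝ ∞ (fun z => F x z) y :=
  (hF.contDiffAt hW h).comp y (f := fun z => (x, z)) (by fun_prop)

theorem SmoothOn.differentiableAt_left (hF : SmoothOn W F) (hW : IsOpen W) {x y : Vec n}
    (h : (x, y) ∈ W) : DifferentiableAt ℝ (fun z => F z y) x :=
  (hF.contDiffAt_left hW h).differentiableAt (by simp)

theorem SmoothOn.differentiableAt_right (hF : SmoothOn W F) (hW : IsOpen W) {x y : Vec n}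
    (h : (x, y) ∈ W) : DifferentiableAt ℝ (fun z => F x z) y :=
  (hF.contDiffAt_right hW h).differentiableAt (by simp)

theorem derivX_eq_fderiv {x y : Vec n} (k : Fin n)
    (h : DifferentiableAt ℝ (fun p : Vec n × Vec n => F p.1 p.2) (x, y)) :
    derivX k F x y = fderiv ℝ (fun p : Vec n × Vec n => F p.1 p.2) (x, y) (Pi.single k 1, 0) :=
  (HasFDerivAt.comp (f := fun z => (z, y)) x h.hasFDerivAt
    (hasFDerivAt_prodMk_left x y)).pderiv_eq

theorem derivY_eq_fderiv {x y : Vec n} (k : Fin n)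
    (h : DifferentiableAt ℝ (fun p : Vec n × Vec n => F p.1 p.2) (x, y)) :
    derivY k F x y = fderiv ℝ (fun p : Vec n × Vec n => F p.1 p.2) (x, y) (0, Pi.single k 1) :=
  (HasFDerivAt.comp (f := fun z => (x, z)) y h.hasFDerivAt
    (hasFDerivAt_prodMk_right x y)).pderiv_eq

theorem SmoothOn.derivX (hF : SmoothOn W F) (hW : IsOpen W) (k : Fin n) :
    SmoothOn W (derivX k F) := by
  have h : ContDiffOn ℝ ∞ (fun p => fderiv ℝ (fun p : Vec n × Vec n => F p.1 p.2) p
      (Pi.single k 1, 0)) W :=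
    (ContDiffOn.fderiv_of_isOpen hF hW (by simp)).clm_apply contDiffOn_const
  exact h.congr fun p hp => derivX_eq_fderiv k (hF.differentiableAt hW hp)

theorem SmoothOn.derivY (hF : SmoothOn W F) (hW : IsOpen W) (k : Fin n) :
    SmoothOn W (derivY k F) := by
  have h : ContDiffOn ℝ ∞ (fun p => fderiv ℝ (fun p : Vec n × Vec n => F p.1 p.2) p
      (0, Pi.single k 1)) W :=
    (ContDiffOn.fderiv_of_isOpen hF hW (by simp)).clm_apply contDiffOn_const
  exact h.congr fun p hp => derivY_eq_fderiv k (hF.differentiableAt hW hp)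

theorem SmoothOn.sqr (hF : SmoothOn W F) : SmoothOn W (sqr F) := ContDiffOn.pow hF 2

theorem eventually_left (hW : IsOpen W) {x y : Vec n} (h : (x, y) ∈ W) :
    ∀ᶠ z in nhds x, (z, y) ∈ W :=
  (show Continuous fun z : Vec n => (z, y) by fun_prop).continuousAt.eventually (hW.mem_nhds h)

theorem eventually_right (hW : IsOpen W) {x y : Vec n} (h : (x, y) ∈ W) :
    ∀ᶠ z in nhds y, (x, z) ∈ W :=
  (show Continuous fun z : Vec n => (x, z) by fun_prop).continuousAt.eventually (hW.mem_nhds h)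

theorem derivX_congr (hW : IsOpen W) (h : ∀ x y, (x, y) ∈ W → F x y = G x y) (k : Fin n)
    {x y : Vec n} (hxy : (x, y) ∈ W) : derivX k F x y = derivX k G x y :=
  pderiv_congr ((eventually_left hW hxy).mono fun _ hz => h _ _ hz)

theorem derivY_congr (hW : IsOpen W) (h : ∀ x y, (x, y) ∈ W → F x y = G x y) (k : Fin n)
    {x y : Vec n} (hxy : (x, y) ∈ W) : derivY k F x y = derivY k G x y :=
  pderiv_congr ((eventually_right hW hxy).mono fun _ hz => h _ _ hz)

theorem derivY_comm (hF : SmoothOn W F) (hW : IsOpen W) (i j : Fin n) {x y : Vec n}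
    (h : (x, y) ∈ W) : derivY j (derivY i F) x y = derivY i (derivY j F) x y := by
  have hc := hF.contDiffAt_right hW h
  have hs := hc.isSymmSndFDerivAt (by simpa using ENat.LEInfty.out)
  have hd : DifferentiableAt ℝ (fderiv ℝ (F x)) y :=
    (hc.fderiv_right (m := 1) (by norm_cast)).differentiableAt (by simp)
  have key : ∀ i j : Fin n, Finsler.derivY j (Finsler.derivY i F) x y =
      fderiv ℝ (fderiv ℝ (F x)) y (Pi.single j 1) (Pi.single i 1) := by
    intro i j
    have := (hd.hasFDerivAt.clm_apply (hasFDerivAt_const (Pi.single i (1 : ℝ)) y)).pderiv_eq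
      (k := j)
    simp only [ContinuousLinearMap.comp_zero, zero_add,
      ContinuousLinearMap.flip_apply] at this
    exact this
  rw [key, key]
  exact hs _ _

/-! Congruence of the spray. -/

theorem derivX_sqr_congr (hW : IsOpen W) (h : ∀ x y, (x, y) ∈ W → F x y = G x y) (k : Fin n)
    {x y : Vec n} (hxy : (x, y) ∈ W) : derivX k (sqr F) x y = derivX k (sqr G) x y :=
  derivX_congr hW (fun x y hxy => by rw [sqr, sqr, h x y hxy]) k hxy

theorem derivY_sqr_congr (hW : IsOpen W) (h : ∀ x y, (x, y) ∈ W → F x y = G x y) (k : Fin n)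
    {x y : Vec n} (hxy : (x, y) ∈ W) : derivY k (sqr F) x y = derivY k (sqr G) x y :=
  derivY_congr hW (fun x y hxy => by rw [sqr, sqr, h x y hxy]) k hxy

theorem fundTensor_congr (hW : IsOpen W) (h : ∀ x y, (x, y) ∈ W → F x y = G x y)
    {x y : Vec n} (hxy : (x, y) ∈ W) : fundTensor F x y = fundTensor G x y := by
  ext i j
  simp only [fundTensor, Matrix.of_apply]
  rw [derivY_congr hW (fun x y hxy => derivY_sqr_congr hW h i hxy) j hxy]

theorem spray_congr (hW : IsOpen W) (h : ∀ x y, (x, y) ∈ W → F x y = G x y)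
    {x y : Vec n} (hxy : (x, y) ∈ W) : spray F x y = spray G x y := by
  ext i
  simp only [spray, fundTensor_congr hW h hxy, derivX_sqr_congr hW h _ hxy,
    fun k l => derivY_congr hW (fun x y hxy => derivX_sqr_congr hW h k hxy) l hxy]

theorem IsProjectivelyFlat.congr {U : Set (Vec n)} (hU : IsOpen U)
    (h : ∀ x ∈ U, ∀ y, F x y = G x y) (hF : IsProjectivelyFlat U F) : IsProjectivelyFlat U G := by
  rintro t₀ t₁ c ⟨v, hv⟩
  refine hF t₀ t₁ c ⟨v, fun t ht => ?_⟩
  obtain ⟨h1, h2, h3, h4⟩ := hv t ht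
  refine ⟨h1, h2, h3, ?_⟩
  rwa [spray_congr (W := U ×ˢ Set.univ) (hU.prod isOpen_univ) (fun x y hxy => h x hxy.1 y)
    ⟨h1, trivial⟩]

/-- The region `{(x, y) | x ∈ U, y ≠ 0}` of the tangent bundle. -/
def slit (U : Set (Vec n)) : Set (Vec n × Vec n) := U ×ˢ {y | y ≠ 0}

theorem isOpen_slit {U : Set (Vec n)} (hU : IsOpen U) : IsOpen (slit U) :=
  hU.prod isOpen_ne

theorem mk_mem_slit {U : Set (Vec n)} {x y : Vec n} (hx : x ∈ U) (hy : y ≠ 0) :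
    (x, y) ∈ slit U := ⟨hx, hy⟩

end Finsler

namespace Finsler

variable {n : ℕ} {U : Set (Vec n)} {W : Set (Vec n × Vec n)} {F : Vec n → Vec n → ℝ} {x y : Vec n}

/-! Homogeneous functions. -/

/-- Euler's relation, from differentiating `c ↦ f (c • y)` at `c = 1`. -/
theorem fderiv_self_of_homogeneous {f : Vec n → ℝ} {y : Vec n} (hf : DifferentiableAt ℝ f y)
    (h : ∀ c : ℝ, 0 < c → f (c • y) = c * f y) : fderiv ℝ f y y = f y := by
  have h1 : HasDerivAt (fun c : ℝ => c • y) y 1 := by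
    simpa using (hasDerivAt_id (1 : ℝ)).smul_const y
  have h2 : HasDerivAt (fun c : ℝ => f (c • y)) (fderiv ℝ f y y) 1 := by
    have hf' : HasFDerivAt f (fderiv ℝ f y) ((1 : ℝ) • y) := by simpa using hf.hasFDerivAt
    exact hf'.comp_hasDerivAt (1 : ℝ) h1
  have h3 : HasDerivAt (fun c : ℝ => c * f y) (f y) 1 := by
    simpa using (hasDerivAt_id (1 : ℝ)).mul_const (f y)
  refine h2.unique (h3.congr_of_eventuallyEq ?_)
  filter_upwards [lt_mem_nhds (zero_lt_one' ℝ)] with c hc using h c hc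

theorem fderiv_self_of_homogeneous_zero {f : Vec n → ℝ} {y : Vec n} (hf : DifferentiableAt ℝ f y)
    (h : ∀ c : ℝ, 0 < c → f (c • y) = f y) : fderiv ℝ f y y = 0 := by
  have h1 : HasDerivAt (fun c : ℝ => c • y) y 1 := by
    simpa using (hasDerivAt_id (1 : ℝ)).smul_const y
  have h2 : HasDerivAt (fun c : ℝ => f (c • y)) (fderiv ℝ f y y) 1 := by
    have hf' : HasFDerivAt f (fderiv ℝ f y) ((1 : ℝ) • y) := by simpa using hf.hasFDerivAt
    exact hf'.comp_hasDerivAt (1 : ℝ) h1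
  refine h2.unique ((hasDerivAt_const (1 : ℝ) (f y)).congr_of_eventuallyEq ?_)
  filter_upwards [lt_mem_nhds (zero_lt_one' ℝ)] with c hc using h c hc

theorem derivY_homogeneous (h : ∀ y, ∀ c : ℝ, 0 < c → F x (c • y) = c * F x y) (k : Fin n)
    {c : ℝ} (hc : 0 < c) : derivY k F x (c • y) = derivY k F x y := by
  have h1 := pderiv_comp_smul k c (F x) y
  have h2 : (fun z => F x (c • z)) = fun z => c * F x z := funext fun z => h z c hc
  rw [h2, pderiv_const_mul] at h1
  exact (mul_left_cancel₀ hc.ne' h1).symm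

theorem derivX_homogeneous (hU : IsOpen U) (h : ∀ x ∈ U, ∀ y, ∀ c : ℝ, 0 < c →
    F x (c • y) = c * F x y) (hx : x ∈ U) (k : Fin n) {c : ℝ} (hc : 0 < c) :
    derivX k F x (c • y) = c * derivX k F x y := by
  rw [derivX, derivX, ← pderiv_const_mul]
  exact pderiv_congr ((hU.eventually_mem hx).mono fun z hz => h z hz y c hc)

/-! The gradient of `F` in `y`, its derivative along `y`, and the Hamel operator. -/

/-- The vector `F_{yˡ}`. -/
noncomputable def gradY (F : Vec n → Vec n → ℝ) (x y : Vec n) : Vec n := fun l => derivY l F x y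

/-- `F_{xᵏ} yᵏ`. -/
noncomputable def flowDeriv (F : Vec n → Vec n → ℝ) (x y : Vec n) : ℝ := ∑ k, derivX k F x y * y k

/-- `F_{xᵏ yˡ} yᵏ - F_{xˡ}`, whose vanishing characterises projective flatness. -/
noncomputable def hamel (F : Vec n → Vec n → ℝ) (x y : Vec n) : Vec n := fun l =>
  ∑ k, derivY l (derivX k F) x y * y k - derivX l F x y

theorem hamel_congr {G : Vec n → Vec n → ℝ} (hW : IsOpen W)
    (h : ∀ x y, (x, y) ∈ W → F x y = G x y) (hxy : (x, y) ∈ W) : hamel F x y = hamel G x y := by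
  ext l
  simp only [hamel, derivX_congr hW h l hxy,
    fun k => derivY_congr hW (fun x y hxy => derivX_congr hW h k hxy) l hxy]

theorem derivY_sqr (hF : SmoothOn W F) (hW : IsOpen W) (i : Fin n) (h : (x, y) ∈ W) :
    derivY i (sqr F) x y = 2 * (F x y * derivY i F x y) := by
  have hd := hF.differentiableAt_right hW h
  have : (fun z => sqr F x z) = fun z => F x z * F x z := funext fun z => sq _
  rw [derivY, this, pderiv_mul hd hd]
  simp only [derivY]; ring

theorem derivX_sqr (hF : SmoothOn W F) (hW : IsOpen W) (i : Fin n) (h : (x, y) ∈ W) :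
    derivX i (sqr F) x y = 2 * (F x y * derivX i F x y) := by
  have hd := hF.differentiableAt_left hW h
  have : (fun z => sqr F z y) = fun z => F z y * F z y := funext fun z => sq _
  rw [derivX, this, pderiv_mul hd hd]
  simp only [derivX]; ring

theorem derivY_derivX_sqr (hF : SmoothOn W F) (hW : IsOpen W) (k l : Fin n) (h : (x, y) ∈ W) :
    derivY l (derivX k (sqr F)) x y =
      2 * (derivY l F x y * derivX k F x y + F x y * derivY l (derivX k F) x y) := by
  rw [derivY_congr hW (fun x y hxy => derivX_sqr hF hW k hxy) l h, derivY, pderiv_const_mul,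
    pderiv_mul (hF.differentiableAt_right hW h) ((hF.derivX hW k).differentiableAt_right hW h)]
  simp only [derivY]; ring

theorem fundTensor_apply (hF : SmoothOn W F) (hW : IsOpen W) (i j : Fin n) (h : (x, y) ∈ W) :
    fundTensor F x y i j =
      derivY i F x y * derivY j F x y + F x y * derivY j (derivY i F) x y := by
  rw [fundTensor, Matrix.of_apply, derivY_congr hW (fun x y hxy => derivY_sqr hF hW i hxy) j h,
    derivY, pderiv_const_mul,
    pderiv_mul (hF.differentiableAt_right hW h) ((hF.derivY hW i).differentiableAt_right hW h)]
  simp only [derivY]; ring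

/-- The spray is written with `F²`, Hamel's equations with `F`. The product rule relates the two, at
the cost of a multiple of the gradient. -/
theorem hamel_sqr (hF : SmoothOn W F) (hW : IsOpen W) (h : (x, y) ∈ W) :
    hamel (sqr F) x y = (2 * flowDeriv F x y) • gradY F x y + (2 * F x y) • hamel F x y := by
  ext l
  simp only [hamel, derivY_derivX_sqr hF hW _ _ h, derivX_sqr hF hW _ h, Pi.add_apply,
    Pi.smul_apply, smul_eq_mul, gradY, flowDeriv, mul_sub, Finset.mul_sum, Finset.sum_mul,
    add_sub_assoc']
  congr 1
  · rw [← Finset.sum_add_distrib]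
    exact Finset.sum_congr rfl fun k _ => by ring
  · ring

theorem spray_eq (F : Vec n → Vec n → ℝ) (x y : Vec n) :
    spray F x y = (1 / 4 : ℝ) • ((fundTensor F x y)⁻¹ *ᵥ hamel (sqr F) x y) := rfl

theorem gradY_dotProduct (hF : SmoothOn W F) (hW : IsOpen W) (h : (x, y) ∈ W)
    (hh : ∀ y, ∀ c : ℝ, 0 < c → F x (c • y) = c * F x y) : gradY F x y ⬝ᵥ y = F x y :=
  (sum_pderiv_mul (F x) y y).trans
    (fderiv_self_of_homogeneous (hF.differentiableAt_right hW h) fun c hc => hh y c hc)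

theorem sum_derivY_derivY_mul (hF : SmoothOn W F) (hW : IsOpen W) (h : (x, y) ∈ W)
    (hh : ∀ y, ∀ c : ℝ, 0 < c → F x (c • y) = c * F x y) (i : Fin n) :
    ∑ j, derivY j (derivY i F) x y * y j = 0 :=
  (sum_pderiv_mul (derivY i F x) y y).trans
    (fderiv_self_of_homogeneous_zero ((hF.derivY hW i).differentiableAt_right hW h)
      fun _ hc => derivY_homogeneous hh i hc)

/-- Each `F_{xᵏ}` is again homogeneous of degree one in `y`, so by Euler's relation both terms
contract with `y` to `F_{xᵏ} yᵏ`. -/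
theorem hamel_dotProduct (hU : IsOpen U) (hF : SmoothOn (slit U) F) (hx : x ∈ U) (hy : y ≠ 0)
    (hh : ∀ x ∈ U, ∀ y, ∀ c : ℝ, 0 < c → F x (c • y) = c * F x y) : hamel F x y ⬝ᵥ y = 0 := by
  have h := mk_mem_slit hx hy
  have key : ∀ k, ∑ l, derivY l (derivX k F) x y * y l = derivX k F x y := fun k =>
    (sum_pderiv_mul (derivX k F x) y y).trans (fderiv_self_of_homogeneous
      ((hF.derivX (isOpen_slit hU) k).differentiableAt_right (isOpen_slit hU) h)
      fun c hc => derivX_homogeneous hU hh hx k hc)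
  simp only [dotProduct, hamel, sub_mul, Finset.sum_sub_distrib, Finset.sum_mul]
  rw [Finset.sum_comm, sub_eq_zero]
  refine Finset.sum_congr rfl fun k _ => ?_
  rw [← key k, Finset.sum_mul]
  exact Finset.sum_congr rfl fun l _ => by ring

/-- The gradient part contracts to `F` by Euler's relation, and the Hessian of a function
homogeneous of degree one annihilates `y`. -/
theorem fundTensor_mulVec_self (hF : SmoothOn W F) (hW : IsOpen W) (h : (x, y) ∈ W)
    (hh : ∀ y, ∀ c : ℝ, 0 < c → F x (c • y) = c * F x y) :
    fundTensor F x y *ᵥ y = F x y • gradY F x y := by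
  ext i
  have h1 := gradY_dotProduct hF hW h hh
  have h2 := sum_derivY_derivY_mul hF hW h hh i
  simp only [Matrix.mulVec, dotProduct, fundTensor_apply hF hW _ _ h, add_mul,
    Finset.sum_add_distrib, Pi.smul_apply, smul_eq_mul, gradY, mul_assoc, ← Finset.mul_sum, h2]
  simp only [dotProduct, gradY] at h1
  rw [h1]; ring

/-! Projective flatness and the Hamel equations. -/

theorem IsFinslerMetric.smoothOn (hF : IsFinslerMetric U F) : SmoothOn (slit U) F := hF.smooth

theorem IsFinslerMetric.pos (hU : IsOpen U) (hF : IsFinslerMetric U F) (hx : x ∈ U) (hy : y ≠ 0) :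
    0 < F x y := by
  have h1 := (hF.stronglyConvex x hx y hy).dotProduct_mulVec_pos hy
  rw [fundTensor_mulVec_self hF.smoothOn (isOpen_slit hU) (mk_mem_slit hx hy)
    (hF.homogeneous x hx), star_trivial, dotProduct_smul, dotProduct_comm,
    gradY_dotProduct hF.smoothOn (isOpen_slit hU) (mk_mem_slit hx hy) (hF.homogeneous x hx),
    smul_eq_mul] at h1
  exact lt_of_le_of_ne (hF.nonneg x hx y) fun h => by simp [← h] at h1

theorem IsFinslerMetric.isUnit_det (hF : IsFinslerMetric U F) (hx : x ∈ U) (hy : y ≠ 0) :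
    IsUnit (fundTensor F x y).det :=
  ((Matrix.isUnit_iff_isUnit_det _).1 (hF.stronglyConvex x hx y hy).isUnit)

/-- Since `g y = F • gradY F`, the inverse of `g` sends the gradient to a multiple of `y`. So
everything in the spray beyond an explicit radial term comes from the Hamel vector. -/
theorem IsFinslerMetric.spray_eq_add (hU : IsOpen U) (hF : IsFinslerMetric U F) (hx : x ∈ U)
    (hy : y ≠ 0) : spray F x y = (flowDeriv F x y / (2 * F x y)) • y +
      (F x y / 2) • ((fundTensor F x y)⁻¹ *ᵥ hamel F x y) := by
  have hpos := hF.pos hU hx hy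
  have h1 : (fundTensor F x y)⁻¹ *ᵥ gradY F x y = (F x y)⁻¹ • y := by
    have h2 := fundTensor_mulVec_self hF.smoothOn (isOpen_slit hU) (mk_mem_slit hx hy)
      (hF.homogeneous x hx)
    have h3 : gradY F x y = (F x y)⁻¹ • (fundTensor F x y *ᵥ y) := by
      rw [h2, smul_smul, inv_mul_cancel₀ hpos.ne', one_smul]
    rw [h3, Matrix.mulVec_smul, Matrix.mulVec_mulVec,
      Matrix.nonsing_inv_mul _ (hF.isUnit_det hx hy), Matrix.one_mulVec]
  rw [spray_eq, hamel_sqr hF.smoothOn (isOpen_slit hU) (mk_mem_slit hx hy), Matrix.mulVec_add,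
    Matrix.mulVec_smul, Matrix.mulVec_smul, h1, smul_add, smul_smul, smul_smul, smul_smul]
  congr 2
  · field_simp; ring
  · ring

theorem IsFinslerMetric.spray_of_hamel (hU : IsOpen U) (hF : IsFinslerMetric U F) (hx : x ∈ U)
    (hy : y ≠ 0) (h : hamel F x y = 0) :
    spray F x y = (flowDeriv F x y / (2 * F x y)) • y := by
  rw [hF.spray_eq_add hU hx hy, h, Matrix.mulVec_zero, smul_zero, add_zero]

/-- A radial spray makes the Hamel vector a multiple of the gradient. Its pairing with `y` vanishes
by `hamel_dotProduct` while that of the gradient is `F > 0`, so the multiple is zero. -/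
theorem IsFinslerMetric.hamel_of_spray (hU : IsOpen U) (hF : IsFinslerMetric U F) (hx : x ∈ U)
    (hy : y ≠ 0) {c : ℝ} (h : spray F x y = c • y) : hamel F x y = 0 := by
  have hpos := hF.pos hU hx hy
  rw [hF.spray_eq_add hU hx hy] at h
  set m := flowDeriv F x y / (2 * F x y)
  have h1 : (fundTensor F x y)⁻¹ *ᵥ hamel F x y = ((c - m) * (2 / F x y)) • y := by
    have h2 : (F x y / 2) • ((fundTensor F x y)⁻¹ *ᵥ hamel F x y) = (c - m) • y := by
      rw [sub_smul, ← h]; abel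
    rw [mul_comm, mul_smul, ← h2, smul_smul]
    have : 2 / F x y * (F x y / 2) = 1 := by field_simp
    rw [this, one_smul]
  set μ := (c - m) * (2 / F x y)
  have h3 : hamel F x y = (μ * F x y) • gradY F x y := by
    have := congrArg (fundTensor F x y *ᵥ ·) h1
    simp only [Matrix.mulVec_mulVec, Matrix.mul_nonsing_inv _ (hF.isUnit_det hx hy),
      Matrix.one_mulVec, Matrix.mulVec_smul] at this
    rw [this, fundTensor_mulVec_self hF.smoothOn (isOpen_slit hU) (mk_mem_slit hx hy)
      (hF.homogeneous x hx), smul_smul]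
  have h4 := hamel_dotProduct hU hF.smoothOn hx hy hF.homogeneous
  rw [h3, smul_dotProduct, gradY_dotProduct hF.smoothOn (isOpen_slit hU) (mk_mem_slit hx hy)
    (hF.homogeneous x hx), smul_eq_mul, mul_assoc] at h4
  have h5 : μ = 0 := by
    rcases mul_eq_zero.1 h4 with h | h
    · exact h
    · exact absurd h (mul_pos hpos hpos).ne'
  rw [h3, h5, zero_mul, zero_smul]

/-- Hamel's criterion, first half. -/
theorem isProjectivelyFlat_of_hamel [NeZero n] (hU : IsOpen U) (hF : IsFinslerMetric U F)
    (h : ∀ x ∈ U, ∀ y, y ≠ 0 → hamel F x y = 0) : IsProjectivelyFlat U F := by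
  rintro t₀ t₁ c ⟨v, hv⟩
  obtain hlt | hle := lt_or_ge t₀ t₁
  swap
  -- The time interval is empty, so any line will do.
  · refine ⟨0, Pi.single 0 1, fun h => ?_, fun t ht => absurd (ht.1.trans ht.2) hle.not_gt⟩
    simpa using congrFun h 0
  obtain ⟨s, hs⟩ : (Set.Ioo t₀ t₁).Nonempty := Set.nonempty_Ioo.2 hlt
  have hpre : IsPreconnected (Set.Ioo t₀ t₁) := isPreconnected_Ioo
  have hconst : ∀ g : ℝ → ℝ, (∀ t ∈ Set.Ioo t₀ t₁, HasDerivAt g 0 t) →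
      ∀ t ∈ Set.Ioo t₀ t₁, g t = g s := fun g hg t ht =>
    isOpen_Ioo.is_const_of_deriv_eq_zero hpre
      (fun r hr => (hg r hr).differentiableAt.differentiableWithinAt)
      (fun r hr => (hg r hr).deriv) ht hs
  have hv' : ∀ t ∈ Set.Ioo t₀ t₁, ∃ l : ℝ, HasDerivAt v (l • v t) t := by
    intro t ht
    obtain ⟨h1, h2, -, h4⟩ := hv t ht
    rw [hF.spray_of_hamel hU h1 h2 (h _ h1 _ h2), smul_smul] at h4
    exact ⟨_, h4⟩
  have hN : ∀ t ∈ Set.Ioo t₀ t₁, 0 < v t ⬝ᵥ v t := fun t ht => by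
    simpa using Matrix.dotProduct_star_self_pos_iff.2 (hv t ht).2.1
  have hN' : ∀ t ∈ Set.Ioo t₀ t₁, ∀ l : ℝ, HasDerivAt v (l • v t) t →
      HasDerivAt (fun t => v t ⬝ᵥ v t) (2 * l * (v t ⬝ᵥ v t)) t := by
    intro t ht l hl
    have h1 : HasDerivAt (fun t => ∑ i, v t i * v t i)
        (∑ i, ((l • v t) i * v t i + v t i * (l • v t) i)) t :=
      HasDerivAt.fun_sum fun i _ => (hasDerivAt_pi.1 hl i).mul (hasDerivAt_pi.1 hl i)
    refine HasDerivAt.congr_deriv h1 ?_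
    rw [show v t ⬝ᵥ v t = ∑ i, v t i * v t i from rfl, Finset.mul_sum]
    exact Finset.sum_congr rfl fun i _ => by simp only [Pi.smul_apply, smul_eq_mul]; ring
  -- The projector onto the line spanned by `v` ignores the length of `v`. As the acceleration is a
  -- multiple of `v`, this projector is constant in time.
  have hproj : ∀ i j, ∀ t ∈ Set.Ioo t₀ t₁, v t i * v t j / (v t ⬝ᵥ v t) =
      v s i * v s j / (v s ⬝ᵥ v s) := by
    intro i j
    refine hconst (fun t => v t i * v t j / (v t ⬝ᵥ v t)) fun t ht => ?_
    obtain ⟨l, hl⟩ := hv' t ht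
    have h1 := ((hasDerivAt_pi.1 hl i).mul (hasDerivAt_pi.1 hl j)).div (hN' t ht l hl)
      (hN t ht).ne'
    refine h1.congr_deriv ?_
    rw [div_eq_zero_iff]
    left; simp only [Pi.mul_apply, Pi.smul_apply, smul_eq_mul]; ring
  have hvt : ∀ t ∈ Set.Ioo t₀ t₁, ∀ i,
      v t i = v s i * ((v s ⬝ᵥ v t) / (v s ⬝ᵥ v s)) := by
    intro t ht i
    have h1 : v t i = ∑ j, v t i * v t j / (v t ⬝ᵥ v t) * v t j := by
      have h2 : ∀ j, v t i * v t j / (v t ⬝ᵥ v t) * v t j =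
        v t i / (v t ⬝ᵥ v t) * (v t j * v t j) := fun j => by ring
      simp only [h2, ← Finset.mul_sum]
      change v t i = v t i / (v t ⬝ᵥ v t) * (v t ⬝ᵥ v t)
      rw [div_mul_cancel₀ _ (hN t ht).ne']
    rw [h1]
    simp only [hproj i _ t ht]
    rw [show v s ⬝ᵥ v t = ∑ j, v s j * v t j from rfl, Finset.sum_div, Finset.mul_sum]
    exact Finset.sum_congr rfl fun j _ => by ring
  -- The component of `c` orthogonal to the fixed direction `v s` has zero derivative, and this
  -- component is the base point of the line.
  have hc : ∀ t ∈ Set.Ioo t₀ t₁, ∀ i, c t i - v s i * ((v s ⬝ᵥ c t) / (v s ⬝ᵥ v s)) =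
      c s i - v s i * ((v s ⬝ᵥ c s) / (v s ⬝ᵥ v s)) := by
    intro t ht i
    refine hconst (fun t => c t i - v s i * ((v s ⬝ᵥ c t) / (v s ⬝ᵥ v s))) (fun r hr => ?_) t ht
    have h1 := hasDerivAt_pi.1 (hv r hr).2.2.1
    have h2 : HasDerivAt (fun t => ∑ j, v s j * c t j) (∑ j, v s j * v r j) r :=
      HasDerivAt.fun_sum fun j _ => (h1 j).const_mul _
    have h3 := (h1 i).sub ((h2.div_const (v s ⬝ᵥ v s)).const_mul (v s i))
    rwa [show v r i - v s i * ((∑ j, v s j * v r j) / (v s ⬝ᵥ v s)) = 0 from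
      sub_eq_zero.2 (hvt r hr i)] at h3
  refine ⟨fun i => c s i - v s i * ((v s ⬝ᵥ c s) / (v s ⬝ᵥ v s)), v s, (hv s hs).2.1,
    fun t ht => ⟨(v s ⬝ᵥ c t) / (v s ⬝ᵥ v s), funext fun i => ?_⟩⟩
  simp only [Pi.add_apply, Pi.smul_apply, smul_eq_mul, ← hc t ht i]
  ring

end Finsler

namespace Finsler

/-! ### Smoothness of the spray, existence of geodesics, and the converse of Hamel's criterion. -/

section Inverse

variable {E ι : Type*} [NormedAddCommGroup E] [NormedSpace ℝ E] [Fintype ι] [DecidableEq ι]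
  {m : WithTop ℕ∞} {A : E → Matrix ι ι ℝ} {z : E}

theorem contDiffAt_det (hA : ∀ i j, ContDiffAt ℝ m (fun w => A w i j) z) :
    ContDiffAt ℝ m (fun w => (A w).det) z := by
  simp only [Matrix.det_apply]
  exact ContDiffAt.sum fun σ _ => ContDiffAt.const_smul _ (contDiffAt_prod fun i _ => hA _ _)

/-- Cramer's rule: the entries are cofactors divided by the determinant. -/
theorem contDiffAt_inv (hA : ∀ i j, ContDiffAt ℝ m (fun w => A w i j) z) (h : (A z).det ≠ 0)
    (i j : ι) : ContDiffAt ℝ m (fun w => (A w)⁻¹ i j) z := by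
  simp only [Matrix.inv_def, Ring.inverse_eq_inv', Matrix.smul_apply, smul_eq_mul,
    Matrix.adjugate_apply]
  refine ((contDiffAt_det hA).inv h).mul (contDiffAt_det fun k l => ?_)
  simp only [Matrix.updateRow_apply]
  split_ifs
  · exact contDiffAt_const
  · exact hA k l

end Inverse

variable {n : ℕ} {U : Set (Vec n)} {F : Vec n → Vec n → ℝ} {x y : Vec n}

theorem IsFinslerMetric.contDiffAt_spray (hU : IsOpen U) (hF : IsFinslerMetric U F) (hx : x ∈ U)
    (hy : y ≠ 0) : ContDiffAt ℝ ∞ (fun p : Vec n × Vec n => spray F p.1 p.2) (x, y) := by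
  have hW := isOpen_slit hU
  have hS := hF.smoothOn.sqr
  have h := mk_mem_slit hx hy
  rw [contDiffAt_pi]
  intro i
  have hg : ∀ i j, ContDiffAt ℝ ∞ (fun p : Vec n × Vec n => fundTensor F p.1 p.2 i j) (x, y) :=
    fun i j => contDiffAt_const.mul (((hS.derivY hW i).derivY hW j).contDiffAt hW h)
  refine contDiffAt_const.mul (ContDiffAt.sum fun l _ => ContDiffAt.mul ?_ (ContDiffAt.sub
    (ContDiffAt.sum fun k _ => ContDiffAt.mul ?_ ?_) ?_))
  · exact contDiffAt_inv (A := fun p : Vec n × Vec n => fundTensor F p.1 p.2) hg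
      (hF.isUnit_det hx hy).ne_zero i l
  · exact ((hS.derivX hW k).derivY hW l).contDiffAt hW h
  · fun_prop
  · exact (hS.derivX hW l).contDiffAt hW h

/-- Local existence of geodesics. -/
theorem IsFinslerMetric.exists_isGeodesic (hU : IsOpen U) (hF : IsFinslerMetric U F) (hx : x ∈ U)
    (hy : y ≠ 0) : ∃ t₀ < 0, ∃ t₁ > 0, ∃ c v : ℝ → Vec n, c 0 = x ∧ v 0 = y ∧
      ∀ t ∈ Set.Ioo t₀ t₁, c t ∈ U ∧ v t ≠ 0 ∧ HasDerivAt c (v t) t ∧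
        HasDerivAt v (-(2 : ℝ) • spray F (c t) (v t)) t := by
  -- The second-order equation as a first-order system in `(c, v)`, ready for Picard-Lindelöf.
  have hf : ContDiffAt ℝ 1 (fun p : Vec n × Vec n => (p.2, -(2 : ℝ) • spray F p.1 p.2)) (x, y) :=
    contDiffAt_snd.prodMk (((hF.contDiffAt_spray hU hx hy).of_le (by simp)).const_smul _)
  obtain ⟨γ, h0, ε, hε, hγ⟩ :=
    hf.exists_forall_mem_closedBall_exists_eq_forall_mem_Ioo_hasDerivAt₀ 0
  have hcont : ContinuousAt γ 0 := (hγ 0 ⟨by linarith, by linarith⟩).continuousAt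
  have hev : ∀ᶠ t in nhds (0 : ℝ), γ t ∈ slit U ∧ t ∈ Set.Ioo (0 - ε) (0 + ε) :=
    (hcont.eventually ((isOpen_slit hU).mem_nhds (by rw [h0]; exact mk_mem_slit hx hy))).and
      (Ioo_mem_nhds (by linarith) (by linarith))
  obtain ⟨t₀, t₁, ht, hsub⟩ := mem_nhds_iff_exists_Ioo_subset.1 hev
  refine ⟨t₀, ht.1, t₁, ht.2, fun t => (γ t).1, fun t => (γ t).2, by simp [h0], by simp [h0],
    fun t ht => ?_⟩
  obtain ⟨h1, h2⟩ := hsub ht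
  exact ⟨h1.1, h1.2, (hγ t h2).fst, (hγ t h2).snd⟩

/-- Hamel's criterion, second half. -/
theorem hamel_eq_zero_of_isProjectivelyFlat (hU : IsOpen U) (hF : IsFinslerMetric U F)
    (hflat : IsProjectivelyFlat U F) (hx : x ∈ U) (hy : y ≠ 0) : hamel F x y = 0 := by
  obtain ⟨t₀, h₀, t₁, h₁, c, v, rfl, rfl, hcv⟩ := hF.exists_isGeodesic hU hx hy
  obtain ⟨p, d, hd, hline⟩ := hflat t₀ t₁ c ⟨v, hcv⟩
  have hzero : ∀ f f' : ℝ → ℝ, ∀ k : ℝ, (∀ t ∈ Set.Ioo t₀ t₁, f t = k) →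
      (∀ t ∈ Set.Ioo t₀ t₁, HasDerivAt f (f' t) t) → ∀ t ∈ Set.Ioo t₀ t₁, f' t = 0 := by
    intro f f' k hf hf' t ht
    refine (hf' t ht).unique ((hasDerivAt_const t k).congr_of_eventuallyEq ?_)
    filter_upwards [Ioo_mem_nhds ht.1 ht.2] with r hr using hf r hr
  -- The minors of `(c, d)` are constant, since `c` lies on a line of direction `d`. Differentiating
  -- once and twice shows that velocity and acceleration are parallel to `d`, so the spray is
  -- radial.
  have hv : ∀ i j, ∀ t ∈ Set.Ioo t₀ t₁, v t i * d j - v t j * d i = 0 := by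
    intro i j
    refine hzero (fun t => c t i * d j - c t j * d i) _ (p i * d j - p j * d i)
      (fun t ht => ?_) fun t ht => ?_
    · obtain ⟨r, hr⟩ := hline t ht
      simp only [hr, Pi.add_apply, Pi.smul_apply, smul_eq_mul]; ring
    · have h := hasDerivAt_pi.1 (hcv t ht).2.2.1
      exact ((h i).mul_const _).sub ((h j).mul_const _)
  have ha : ∀ i j, ∀ t ∈ Set.Ioo t₀ t₁, (-(2 : ℝ) • spray F (c t) (v t)) i * d j -
      (-(2 : ℝ) • spray F (c t) (v t)) j * d i = 0 := by
    intro i j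
    refine hzero (fun t => v t i * d j - v t j * d i) _ 0 (hv i j) fun t ht => ?_
    have h := hasDerivAt_pi.1 (hcv t ht).2.2.2
    exact ((h i).mul_const _).sub ((h j).mul_const _)
  have h0 : (0 : ℝ) ∈ Set.Ioo t₀ t₁ := ⟨h₀, h₁⟩
  obtain ⟨j, hj⟩ : ∃ j, d j ≠ 0 := Function.ne_iff.1 hd
  have hvj : v 0 j ≠ 0 := by
    intro h
    refine hy (funext fun i => ?_)
    have := hv i j 0 h0
    rw [h, zero_mul, sub_zero] at this
    exact (mul_eq_zero.1 this).resolve_right hj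
  refine hF.hamel_of_spray hU hx hy (c := spray F (c 0) (v 0) j / v 0 j) (funext fun i => ?_)
  have e1 := hv i j 0 h0
  have e2 := ha i j 0 h0
  simp only [Pi.smul_apply, smul_eq_mul] at e2 ⊢
  rw [div_mul_eq_mul_div, eq_div_iff hvj]
  refine mul_right_cancel₀ hj ?_
  linear_combination (-1 / 2 * v 0 j) * e2 - spray F (c 0) (v 0) j * e1

/-! Symmetrisation of a Finsler metric. -/

theorem fundTensor_isHermitian (hU : IsOpen U) (hF : SmoothOn (slit U) F) (hx : x ∈ U)
    (hy : y ≠ 0) : (fundTensor F x y).IsHermitian := by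
  ext i j
  simp only [Matrix.conjTranspose_apply, star_trivial, fundTensor, Matrix.of_apply]
  rw [derivY_comm hF.sqr (isOpen_slit hU) j i (mk_mem_slit hx hy)]

/-- The second derivative of `F(x, ·)` in direction `v`. -/
noncomputable def hessY (F : Vec n → Vec n → ℝ) (x y v : Vec n) : ℝ :=
  ∑ i, ∑ j, derivY j (derivY i F) x y * v i * v j

theorem fundTensor_dotProduct (hU : IsOpen U) (hF : SmoothOn (slit U) F) (hx : x ∈ U)
    (hy : y ≠ 0) (v : Vec n) : v ⬝ᵥ fundTensor F x y *ᵥ v =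
      (gradY F x y ⬝ᵥ v) ^ 2 + F x y * hessY F x y v := by
  simp only [dotProduct, Matrix.mulVec, gradY, hessY,
    fundTensor_apply hF (isOpen_slit hU) _ _ (mk_mem_slit hx hy)]
  rw [sq, Finset.sum_mul_sum, Finset.mul_sum, ← Finset.sum_add_distrib]
  refine Finset.sum_congr rfl fun i _ => ?_
  rw [Finset.mul_sum, Finset.mul_sum, ← Finset.sum_add_distrib]
  exact Finset.sum_congr rfl fun j _ => by ring

theorem hessY_sub_smul (hU : IsOpen U) (hF : SmoothOn (slit U) F) (hx : x ∈ U)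
    (hy : y ≠ 0) (hh : ∀ y, ∀ c : ℝ, 0 < c → F x (c • y) = c * F x y) (v : Vec n) (t : ℝ) :
    hessY F x y (v - t • y) = hessY F x y v := by
  have h := mk_mem_slit hx hy
  have hr := sum_derivY_derivY_mul hF (isOpen_slit hU) h hh
  have hc : ∀ j, ∑ i, derivY j (derivY i F) x y * y i = 0 := fun j => by
    rw [← hr j]
    exact Finset.sum_congr rfl fun i _ => by rw [derivY_comm hF (isOpen_slit hU) i j h]
  have e : hessY F x y (v - t • y) = hessY F x y v -
      t * ∑ i, v i * ∑ j, derivY j (derivY i F) x y * y j -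
      t * (∑ j, v j * ∑ i, derivY j (derivY i F) x y * y i) +
      t ^ 2 * ∑ i, y i * ∑ j, derivY j (derivY i F) x y * y j := by
    simp only [hessY, Finset.mul_sum]
    rw [Finset.sum_comm (f := fun j i => t * (v j * (derivY j (derivY i F) x y * y i)))]
    simp only [← Finset.sum_sub_distrib, ← Finset.sum_add_distrib]
    refine Finset.sum_congr rfl fun i _ => Finset.sum_congr rfl fun j _ => ?_
    simp only [Pi.sub_apply, Pi.smul_apply, smul_eq_mul]; ring
  rw [e]
  simp [hr, hc]

/-- Subtracting a multiple of `y` from `v` makes it orthogonal to the gradient without changing the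
Hessian form, and there the fundamental tensor is `F` times the Hessian. Convexity is thereby
expressed by the Hessian of `F`, which, unlike that of `F²`, is additive in `F` and so passes to
averages. -/
theorem IsFinslerMetric.hessY_nonneg (hU : IsOpen U) (hF : IsFinslerMetric U F) (hx : x ∈ U)
    (hy : y ≠ 0) (v : Vec n) : 0 ≤ hessY F x y v ∧
      (hessY F x y v = 0 → ∃ t : ℝ, v = t • y) := by
  have hpos := hF.pos hU hx hy
  set t := (gradY F x y ⬝ᵥ v) / F x y with ht
  have h1 : gradY F x y ⬝ᵥ (v - t • y) = 0 := by
    rw [dotProduct_sub, dotProduct_smul, gradY_dotProduct hF.smoothOn (isOpen_slit hU)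
      (mk_mem_slit hx hy) (hF.homogeneous x hx), smul_eq_mul, ht, div_mul_cancel₀ _ hpos.ne',
      sub_self]
  have h2 := fundTensor_dotProduct hU hF.smoothOn hx hy (v - t • y)
  rw [h1, hessY_sub_smul hU hF.smoothOn hx hy (hF.homogeneous x hx), zero_pow two_ne_zero,
    zero_add] at h2
  have hg := hF.stronglyConvex x hx y hy
  constructor
  · have h3 := hg.posSemidef.dotProduct_mulVec_nonneg (v - t • y)
    rw [star_trivial, h2] at h3
    exact nonneg_of_mul_nonneg_right h3 hpos
  · intro h
    refine ⟨t, sub_eq_zero.1 ?_⟩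
    by_contra hne
    have h3 := hg.dotProduct_mulVec_pos hne
    rw [star_trivial, h2, h, mul_zero] at h3
    exact h3.false

/-- `(F(x, y) + F(x, -y)) / 2`. -/
noncomputable def symmetrization (F : Vec n → Vec n → ℝ) (x y : Vec n) : ℝ :=
  1 / 2 * (F x y + F x (-y))

theorem SmoothOn.comp_neg (hF : SmoothOn (slit U) F) : SmoothOn (slit U) fun x y => F x (-y) :=
  ContDiffOn.comp (f := fun p : Vec n × Vec n => (p.1, -p.2)) hF
    (contDiff_fst.prodMk contDiff_snd.neg).contDiffOn fun _ hp => ⟨hp.1, neg_ne_zero.2 hp.2⟩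

theorem derivY_comp_neg (k : Fin n) (F : Vec n → Vec n → ℝ) (x y : Vec n) :
    derivY k (fun x y => F x (-y)) x y = -derivY k F x (-y) := pderiv_comp_neg _ _ _

theorem derivY_symmetrization (hU : IsOpen U) (hF : SmoothOn (slit U) F) (k : Fin n) (hx : x ∈ U)
    (hy : y ≠ 0) : derivY k (symmetrization F) x y =
      1 / 2 * (derivY k F x y - derivY k F x (-y)) := by
  rw [sub_eq_add_neg, ← derivY_comp_neg k F x y]
  change pderiv k (fun z => 1 / 2 * (F x z + F x (-z))) y = _
  rw [pderiv_const_mul, pderiv_add (hF.differentiableAt_right (isOpen_slit hU) (mk_mem_slit hx hy))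
    (hF.comp_neg.differentiableAt_right (isOpen_slit hU) (mk_mem_slit hx hy))]
  rfl

theorem derivY_derivY_symmetrization (hU : IsOpen U) (hF : SmoothOn (slit U) F) (i j : Fin n)
    (hx : x ∈ U) (hy : y ≠ 0) : derivY j (derivY i (symmetrization F)) x y =
      1 / 2 * (derivY j (derivY i F) x y + derivY j (derivY i F) x (-y)) := by
  have hF' := hF.derivY (isOpen_slit hU) i
  rw [derivY_congr (isOpen_slit hU) (fun x y h => derivY_symmetrization hU hF i h.1 h.2) j
    (mk_mem_slit hx hy)]
  change pderiv j (fun z => 1 / 2 * (derivY i F x z - derivY i F x (-z))) y = _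
  rw [pderiv_const_mul, pderiv_sub (hF'.differentiableAt_right (isOpen_slit hU) (mk_mem_slit hx hy))
    (hF'.comp_neg.differentiableAt_right (isOpen_slit hU) (mk_mem_slit hx hy)), pderiv_comp_neg]
  change 1 / 2 * (derivY j (derivY i F) x y - -derivY j (derivY i F) x (-y)) = _
  ring

theorem IsFinslerMetric.symmetrization (hU : IsOpen U) (hF : IsFinslerMetric U F) :
    IsFinslerMetric U (symmetrization F) where
  continuousOn := by
    refine continuousOn_const.mul (hF.continuousOn.add (hF.continuousOn.comp
      (f := fun p : Vec n × Vec n => (p.1, -p.2)) (by fun_prop) fun _ hp => ⟨hp.1, trivial⟩))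
  nonneg x hx y := by
    have := hF.nonneg x hx y
    have := hF.nonneg x hx (-y)
    unfold Finsler.symmetrization
    positivity
  smooth := contDiffOn_const.mul (ContDiffOn.add hF.smoothOn hF.smoothOn.comp_neg)
  homogeneous x hx y c hc := by
    simp only [Finsler.symmetrization, ← smul_neg, hF.homogeneous x hx _ c hc]; ring
  stronglyConvex x hx y hy := by
    have hs : SmoothOn (slit U) (Finsler.symmetrization F) :=
      contDiffOn_const.mul (ContDiffOn.add hF.smoothOn hF.smoothOn.comp_neg)
    have hy' := neg_ne_zero.2 hy
    have hh : ∀ y, ∀ c : ℝ, 0 < c →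
        Finsler.symmetrization F x (c • y) = c * Finsler.symmetrization F x y := fun y c hc => by
      simp only [Finsler.symmetrization, ← smul_neg, hF.homogeneous x hx _ c hc]; ring
    have hpos : 0 < Finsler.symmetrization F x y := by
      have := hF.pos hU hx hy
      have := hF.pos hU hx hy'
      unfold Finsler.symmetrization
      positivity
    refine Matrix.posDef_iff_dotProduct_mulVec.2 ⟨fundTensor_isHermitian hU hs hx hy,
      fun v hv => ?_⟩
    rw [star_trivial, fundTensor_dotProduct hU hs hx hy]
    have he : hessY (Finsler.symmetrization F) x y v =
        1 / 2 * (hessY F x y v + hessY F x (-y) v) := by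
      simp only [hessY, derivY_derivY_symmetrization hU hF.smoothOn _ _ hx hy]
      rw [← Finset.sum_add_distrib, Finset.mul_sum]
      refine Finset.sum_congr rfl fun i _ => ?_
      rw [← Finset.sum_add_distrib, Finset.mul_sum]
      exact Finset.sum_congr rfl fun j _ => by ring
    obtain ⟨h1, h1'⟩ := hF.hessY_nonneg hU hx hy v
    obtain ⟨h2, -⟩ := hF.hessY_nonneg hU hx hy' v
    -- The Hessian of `F` degenerates only for `v` proportional to `y`, and in that case the squared
    -- gradient term is positive.
    by_cases h0 : hessY F x y v = 0
    · obtain ⟨t, rfl⟩ := h1' h0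
      have ht : t ≠ 0 := fun h => hv (by rw [h, zero_smul])
      rw [dotProduct_smul, gradY_dotProduct hs (isOpen_slit hU) (mk_mem_slit hx hy) hh, smul_eq_mul]
      refine add_pos_of_pos_of_nonneg (by positivity) ?_
      rw [he]; positivity
    · have h3 := lt_of_le_of_ne h1 (Ne.symm h0)
      refine add_pos_of_nonneg_of_pos (by positivity) ?_
      rw [he]; positivity

end Finsler

namespace Finsler

variable {n : ℕ} {U : Set (Vec n)} {a : Vec n → Matrix (Fin n) (Fin n) ℝ} {b : Vec n → Vec n}
  {f : ℝ → ℝ} {x y : Vec n}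

/-! The functions `α`, `β` and `β / α`. -/

/-- The quadratic form `a_{ij}(x) yⁱ yʲ`. -/
noncomputable def quad (a : Vec n → Matrix (Fin n) (Fin n) ℝ) (x y : Vec n) : ℝ :=
  y ⬝ᵥ (a x *ᵥ y)

/-- The function `β / α`. -/
noncomputable def ratio (a : Vec n → Matrix (Fin n) (Fin n) ℝ) (b : Vec n → Vec n)
    (x y : Vec n) : ℝ := beta b x y / alpha a x y

theorem quad_eq_sum (a : Vec n → Matrix (Fin n) (Fin n) ℝ) (x y : Vec n) :
    quad a x y = ∑ i, ∑ j, a x i j * (y i * y j) := by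
  simp only [quad, dotProduct, Matrix.mulVec, Finset.mul_sum]
  exact Finset.sum_congr rfl fun i _ => Finset.sum_congr rfl fun j _ => by ring

theorem quad_pos (ha : IsRiemannianMetric U a) (hx : x ∈ U) (hy : y ≠ 0) : 0 < quad a x y := by
  simpa [quad] using (ha.2 x hx).dotProduct_mulVec_pos hy

theorem quad_nonneg (ha : IsRiemannianMetric U a) (hx : x ∈ U) (y : Vec n) : 0 ≤ quad a x y := by
  simpa [quad] using (ha.2 x hx).posSemidef.dotProduct_mulVec_nonneg y

theorem alpha_pos (ha : IsRiemannianMetric U a) (hx : x ∈ U) (hy : y ≠ 0) : 0 < alpha a x y :=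
  Real.sqrt_pos.2 (quad_pos ha hx hy)

theorem sqr_alpha (ha : IsRiemannianMetric U a) (hx : x ∈ U) (y : Vec n) :
    sqr (alpha a) x y = quad a x y := Real.sq_sqrt (quad_nonneg ha hx y)

theorem alpha_smul (a : Vec n → Matrix (Fin n) (Fin n) ℝ) (x y : Vec n) (c : ℝ) :
    alpha a x (c • y) = |c| * alpha a x y := by
  rw [alpha, alpha, Matrix.mulVec_smul, dotProduct_smul, smul_dotProduct, smul_eq_mul, smul_eq_mul,
    ← mul_assoc, Real.sqrt_mul (mul_self_nonneg c), Real.sqrt_mul_self_eq_abs]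

theorem beta_smul (b : Vec n → Vec n) (x y : Vec n) (c : ℝ) :
    beta b x (c • y) = c * beta b x y := by
  rw [beta, beta, dotProduct_smul, smul_eq_mul]

theorem alpha_neg (a : Vec n → Matrix (Fin n) (Fin n) ℝ) (x y : Vec n) :
    alpha a x (-y) = alpha a x y := by
  simpa using alpha_smul a x y (-1)

theorem beta_neg (b : Vec n → Vec n) (x y : Vec n) : beta b x (-y) = -beta b x y := by
  simpa using beta_smul b x y (-1)

theorem ratio_neg (a : Vec n → Matrix (Fin n) (Fin n) ℝ) (b : Vec n → Vec n) (x y : Vec n) :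
    ratio a b x (-y) = -ratio a b x y := by
  rw [ratio, ratio, alpha_neg, beta_neg, neg_div]

theorem ratio_mul_alpha (ha : IsRiemannianMetric U a) (hx : x ∈ U) (hy : y ≠ 0) :
    ratio a b x y * alpha a x y = beta b x y := div_mul_cancel₀ _ (alpha_pos ha hx hy).ne'

theorem contDiffOn_fst_comp {g : Vec n → ℝ} {V : Set (Vec n)} (hg : ContDiffOn ℝ ∞ g U) :
    ContDiffOn ℝ ∞ (fun p : Vec n × Vec n => g p.1) (U ×ˢ V) :=
  hg.comp contDiff_fst.contDiffOn fun _ hp => hp.1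

theorem smoothOn_quad (ha : IsRiemannianMetric U a) (V : Set (Vec n)) :
    SmoothOn (U ×ˢ V) (quad a) := by
  have h : ContDiffOn ℝ ∞ (fun p : Vec n × Vec n => ∑ i, ∑ j, a p.1 i j * (p.2 i * p.2 j))
      (U ×ˢ V) :=
    ContDiffOn.sum fun i _ => ContDiffOn.sum fun j _ =>
      (contDiffOn_fst_comp (ha.1 i j)).mul (by fun_prop)
  exact h.congr fun p _ => quad_eq_sum a p.1 p.2

theorem smoothOn_beta (hb : IsOneForm U b) (V : Set (Vec n)) : SmoothOn (U ×ˢ V) (beta b) := by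
  have h : ContDiffOn ℝ ∞ (fun p : Vec n × Vec n => ∑ i, b p.1 i * p.2 i) (U ×ˢ V) :=
    ContDiffOn.sum fun i _ => (contDiffOn_fst_comp (hb i)).mul (by fun_prop)
  exact h

theorem smoothOn_alpha (ha : IsRiemannianMetric U a) : SmoothOn (slit U) (alpha a) :=
  ContDiffOn.sqrt (smoothOn_quad ha _) fun _ hp => (quad_pos ha hp.1 hp.2).ne'

theorem smoothOn_ratio (ha : IsRiemannianMetric U a) (hb : IsOneForm U b) :
    SmoothOn (slit U) (ratio a b) :=
  ContDiffOn.div (smoothOn_beta hb _) (smoothOn_alpha ha) fun _ hp => (alpha_pos ha hp.1 hp.2).ne'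

theorem matrix_symm (ha : IsRiemannianMetric U a) (hx : x ∈ U) (i j : Fin n) :
    a x i j = a x j i := by
  simpa using ((ha.2 x hx).1.apply i j).symm

theorem differentiableAt_of_oneForm (hU : IsOpen U) (hb : IsOneForm U b) (hx : x ∈ U)
    (i : Fin n) : DifferentiableAt ℝ (fun z => b z i) x :=
  ((hb i).contDiffAt (hU.mem_nhds hx)).differentiableAt (by simp)

theorem differentiableAt_of_riemannian (hU : IsOpen U) (ha : IsRiemannianMetric U a) (hx : x ∈ U)
    (i j : Fin n) : DifferentiableAt ℝ (fun z => a z i j) x :=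
  ((ha.1 i j).contDiffAt (hU.mem_nhds hx)).differentiableAt (by simp)

theorem derivY_quad (hs : ∀ i j, a x i j = a x j i) (l : Fin n) :
    derivY l (quad a) x y = 2 * (a x *ᵥ y) l := by
  have hd : ∀ i j, DifferentiableAt ℝ (fun z : Vec n => a x i j * (z i * z j)) y := by
    intro i j; fun_prop
  have hd' : ∀ i, DifferentiableAt ℝ (fun z : Vec n => ∑ j, a x i j * (z i * z j)) y := by
    intro i; fun_prop
  have e : ∀ i j, pderiv l (fun z : Vec n => z i * z j) y =
      y i * (if j = l then 1 else 0) + y j * (if i = l then 1 else 0) := fun i j => by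
    rw [pderiv_mul (by fun_prop) (by fun_prop), pderiv_apply, pderiv_apply]
  simp only [derivY, quad_eq_sum]
  rw [pderiv_sum fun i _ => hd' i]
  simp only [fun i => pderiv_sum (k := l) (s := Finset.univ) fun j _ => hd i j, pderiv_const_mul, e,
    mul_add, Finset.sum_add_distrib, mul_ite, mul_one, mul_zero, Finset.sum_ite_eq',
    Finset.mem_univ, if_true]
  rw [Finset.sum_comm]
  simp only [Finset.sum_ite_eq', Finset.mem_univ, if_true, Matrix.mulVec, dotProduct]
  rw [two_mul]
  congr 1
  exact Finset.sum_congr rfl fun i _ => by rw [hs]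

/-- The matrix `∂a_{ij}/∂xᵏ`. -/
noncomputable def matDeriv (k : Fin n) (a : Vec n → Matrix (Fin n) (Fin n) ℝ) (x : Vec n) :
    Matrix (Fin n) (Fin n) ℝ := Matrix.of fun i j => pderiv k (fun z => a z i j) x

theorem matDeriv_symm (hU : IsOpen U) (ha : IsRiemannianMetric U a) (hx : x ∈ U) (k i j : Fin n) :
    matDeriv k a x i j = matDeriv k a x j i :=
  pderiv_congr ((hU.eventually_mem hx).mono fun _ hz => matrix_symm ha hz i j)

theorem derivX_quad (hU : IsOpen U) (ha : IsRiemannianMetric U a) (hx : x ∈ U) (k : Fin n) :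
    derivX k (quad a) x y = quad (matDeriv k a) x y := by
  have hda := differentiableAt_of_riemannian hU ha hx
  have hd : ∀ i j, DifferentiableAt ℝ (fun z : Vec n => a z i j * (y i * y j)) x := fun i j =>
    (hda i j).mul_const _
  simp only [derivX, quad_eq_sum]
  rw [pderiv_sum fun i _ => DifferentiableAt.fun_sum fun j _ => hd i j]
  refine Finset.sum_congr rfl fun i _ => ?_
  rw [pderiv_sum fun j _ => hd i j]
  refine Finset.sum_congr rfl fun j _ => ?_
  rw [pderiv_mul (hda i j) (by fun_prop), pderiv_const, matDeriv, Matrix.of_apply]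
  ring

theorem derivY_alpha (hU : IsOpen U) (ha : IsRiemannianMetric U a) (hx : x ∈ U) (hy : y ≠ 0)
    (l : Fin n) : derivY l (alpha a) x y = (a x *ᵥ y) l / alpha a x y := by
  have h1 := derivY_sqr (smoothOn_alpha ha) (isOpen_slit hU) l (mk_mem_slit hx hy)
  rw [derivY_congr (isOpen_slit hU) (fun x y h => sqr_alpha ha h.1 y) l (mk_mem_slit hx hy),
    derivY_quad (matrix_symm ha hx)] at h1
  rw [eq_div_iff (alpha_pos ha hx hy).ne']
  linarith

theorem derivX_alpha (hU : IsOpen U) (ha : IsRiemannianMetric U a) (hx : x ∈ U) (hy : y ≠ 0)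
    (l : Fin n) : derivX l (alpha a) x y = derivX l (quad a) x y / (2 * alpha a x y) := by
  have h1 := derivX_sqr (smoothOn_alpha ha) (isOpen_slit hU) l (mk_mem_slit hx hy)
  rw [derivX_congr (isOpen_slit hU) (fun x y h => sqr_alpha ha h.1 y) l (mk_mem_slit hx hy)] at h1
  have := alpha_pos ha hx hy
  rw [eq_div_iff (by positivity)]
  linarith

/-! ### The Hamel operator on 1-forms and on functions `α f(β / α)`. -/

theorem derivY_beta (b : Vec n → Vec n) (x y : Vec n) (l : Fin n) :
    derivY l (beta b) x y = b x l := by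
  simp only [derivY, beta, dotProduct]
  rw [pderiv_sum fun i _ => by fun_prop]
  simp [pderiv_const_mul, pderiv_apply]

theorem derivX_beta (hU : IsOpen U) (hb : IsOneForm U b) (hx : x ∈ U) (k : Fin n) (y : Vec n) :
    derivX k (beta b) x y = ∑ i, pderiv k (fun z => b z i) x * y i := by
  have hd := differentiableAt_of_oneForm hU hb hx
  simp only [derivX, beta, dotProduct]
  rw [pderiv_sum fun i _ => (hd i).mul_const _]
  refine Finset.sum_congr rfl fun i _ => ?_
  rw [pderiv_mul (hd i) (by fun_prop), pderiv_const]
  ring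

/-- The matrix `∂b_l/∂xᵏ - ∂b_k/∂xˡ`. -/
noncomputable def curl (b : Vec n → Vec n) (x : Vec n) : Matrix (Fin n) (Fin n) ℝ :=
  Matrix.of fun l k => pderiv k (fun z => b z l) x - pderiv l (fun z => b z k) x

theorem hamel_beta (hU : IsOpen U) (hb : IsOneForm U b) (hx : x ∈ U) (y : Vec n) :
    hamel (beta b) x y = curl b x *ᵥ y := by
  ext l
  have hW : IsOpen (U ×ˢ (Set.univ : Set (Vec n))) := hU.prod isOpen_univ
  have e : ∀ k, derivY l (derivX k (beta b)) x y = pderiv k (fun z => b z l) x := fun k => by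
    rw [derivY_congr hW (G := beta fun x i => pderiv k (fun z => b z i) x)
      (fun x y h => derivX_beta hU hb h.1 k y) l (x := x) (y := y) ⟨hx, trivial⟩, derivY_beta]
  simp only [hamel, e, derivX_beta hU hb hx, Matrix.mulVec, dotProduct, curl, Matrix.of_apply,
    sub_mul, Finset.sum_sub_distrib]

theorem isClosedForm_iff_curl : IsClosedForm U b ↔ ∀ x ∈ U, curl b x = 0 := by
  refine forall₂_congr fun x _ => ⟨fun h => ?_, fun h i j => ?_⟩
  · ext i j
    simp [curl, h i j]
  · simpa [curl, sub_eq_zero] using congrFun (congrFun h i) j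

/-- The function `α ∂ₖ(β / α) yᵏ`. -/
noncomputable def ratioFlow (a : Vec n → Matrix (Fin n) (Fin n) ℝ) (b : Vec n → Vec n)
    (x y : Vec n) : ℝ := flowDeriv (beta b) x y - ratio a b x y * flowDeriv (alpha a) x y

/-- Differentiate `(β/α) α = β` instead of the quotient. -/
theorem alpha_mul_gradY_ratio (hU : IsOpen U) (ha : IsRiemannianMetric U a) (hb : IsOneForm U b)
    (hx : x ∈ U) (hy : y ≠ 0) (l : Fin n) : alpha a x y * derivY l (ratio a b) x y =
      b x l - ratio a b x y * derivY l (alpha a) x y := by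
  have h := mk_mem_slit hx hy
  have h1 := derivY_congr (isOpen_slit hU) (F := beta b)
    (G := fun x y => ratio a b x y * alpha a x y)
    (fun x y h => (ratio_mul_alpha ha h.1 h.2).symm) l h
  rw [derivY_beta, derivY,
    pderiv_mul ((smoothOn_ratio ha hb).differentiableAt_right (isOpen_slit hU) h)
    ((smoothOn_alpha ha).differentiableAt_right (isOpen_slit hU) h)] at h1
  rw [h1]
  simp only [derivY]; ring

theorem alpha_mul_derivX_ratio (hU : IsOpen U) (ha : IsRiemannianMetric U a) (hb : IsOneForm U b)
    (hx : x ∈ U) (hy : y ≠ 0) (k : Fin n) : alpha a x y * derivX k (ratio a b) x y =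
      derivX k (beta b) x y - ratio a b x y * derivX k (alpha a) x y := by
  have h := mk_mem_slit hx hy
  have h1 := derivX_congr (isOpen_slit hU) (F := beta b)
    (G := fun x y => ratio a b x y * alpha a x y)
    (fun x y h => (ratio_mul_alpha ha h.1 h.2).symm) k h
  simp only [derivX] at h1 ⊢
  rw [h1, pderiv_mul ((smoothOn_ratio ha hb).differentiableAt_left (isOpen_slit hU) h)
    ((smoothOn_alpha ha).differentiableAt_left (isOpen_slit hU) h)]
  ring

theorem derivX_alphaBeta (hU : IsOpen U) (ha : IsRiemannianMetric U a) (hb : IsOneForm U b)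
    (hx : x ∈ U) (hy : y ≠ 0) (hf : DifferentiableAt ℝ f (ratio a b x y)) (k : Fin n) :
    derivX k (alphaBeta a b f) x y =
      (f (ratio a b x y) - ratio a b x y * deriv f (ratio a b x y)) * derivX k (alpha a) x y +
        deriv f (ratio a b x y) * derivX k (beta b) x y := by
  have h := mk_mem_slit hx hy
  have hr := (smoothOn_ratio ha hb).differentiableAt_left (isOpen_slit hU) h
  have h1 := alpha_mul_derivX_ratio hU ha hb hx hy k
  change pderiv k (fun z => alpha a z y * f (ratio a b z y)) x = _
  rw [pderiv_mul ((smoothOn_alpha ha).differentiableAt_left (isOpen_slit hU) h)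
    (DifferentiableAt.fun_comp' x hf hr), pderiv_comp (f := fun z => ratio a b z y) hf hr]
  simp only [derivX] at h1 ⊢
  linear_combination deriv f (ratio a b x y) * h1

/-- The Hamel operator applied to `α f(β / α)`. -/
theorem hamel_alphaBeta (hU : IsOpen U) (ha : IsRiemannianMetric U a) (hb : IsOneForm U b)
    {D : Set ℝ} (hD : IsOpen D) (hf : ContDiffOn ℝ ∞ f D)
    (hmem : ∀ x y, (x, y) ∈ slit U → ratio a b x y ∈ D) (hx : x ∈ U) (hy : y ≠ 0) :
    hamel (alphaBeta a b f) x y =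
      (f (ratio a b x y) - ratio a b x y * deriv f (ratio a b x y)) • hamel (alpha a) x y +
      deriv f (ratio a b x y) • curl b x *ᵥ y +
      (deriv (deriv f) (ratio a b x y) * ratioFlow a b x y) • gradY (ratio a b) x y := by
  have h := mk_mem_slit hx hy
  have hW := isOpen_slit hU
  have hdf : ∀ s ∈ D, DifferentiableAt ℝ f s := fun s hs =>
    (hf.contDiffAt (hD.mem_nhds hs)).differentiableAt (by simp)
  have hdf' : DifferentiableAt ℝ (deriv f) (ratio a b x y) :=
    ((hf.deriv_of_isOpen (m := ∞) hD (by simp)).contDiffAt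
      (hD.mem_nhds (hmem x y h))).differentiableAt (by simp)
  have hdf0 := hdf _ (hmem x y h)
  have hα := smoothOn_alpha ha
  have hβ : SmoothOn (slit U) (beta b) := smoothOn_beta hb _
  have hr := (smoothOn_ratio ha hb).differentiableAt_right hW h
  -- The derivative of `f - s f'` is `-s f''`. Together with the `f''` from differentiating `f'`, it
  -- makes the factor `β_{xᵏ} - s α_{xᵏ}`, which sums to `ratioFlow`.
  have hg : HasDerivAt (fun s => f s - s * deriv f s)
      (-(ratio a b x y * deriv (deriv f) (ratio a b x y))) (ratio a b x y) := by
    refine (hdf0.hasDerivAt.sub ((hasDerivAt_id' _).mul hdf'.hasDerivAt)).congr_deriv ?_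
    ring
  have key : ∀ l k, derivY l (derivX k (alphaBeta a b f)) x y =
      (f (ratio a b x y) - ratio a b x y * deriv f (ratio a b x y)) *
        derivY l (derivX k (alpha a)) x y +
      deriv f (ratio a b x y) * derivY l (derivX k (beta b)) x y +
      deriv (deriv f) (ratio a b x y) * derivY l (ratio a b) x y *
        (derivX k (beta b) x y - ratio a b x y * derivX k (alpha a) x y) := by
    intro l k
    rw [derivY_congr hW (G := fun x y => (f (ratio a b x y) - ratio a b x y *
      deriv f (ratio a b x y)) * derivX k (alpha a) x y + deriv f (ratio a b x y) *
      derivX k (beta b) x y) (fun x y h => derivX_alphaBeta hU ha hb h.1 h.2 (hdf _ (hmem x y h)) k) l h]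
    have d1 := (hα.derivX hW k).differentiableAt_right hW h
    have d2 := (hβ.derivX hW k).differentiableAt_right hW h
    have d3 : DifferentiableAt ℝ (fun z => f (ratio a b x z) -
        ratio a b x z * deriv f (ratio a b x z)) y :=
      DifferentiableAt.fun_comp' (g := fun s => f s - s * deriv f s) y hg.differentiableAt hr
    have d4 : DifferentiableAt ℝ (fun z => deriv f (ratio a b x z)) y :=
      DifferentiableAt.fun_comp' y hdf' hr
    rw [derivY, pderiv_add (d3.fun_mul d1) (d4.fun_mul d2), pderiv_mul d3 d1, pderiv_mul d4 d2,
      pderiv_comp (g := fun s => f s - s * deriv f s) hg.differentiableAt hr, hg.deriv,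
      pderiv_comp hdf' hr]
    simp only [derivY]; ring
  ext l
  have e : ∀ (A B C r : ℝ) (p q u w : Fin n → ℝ),
      ∑ k, (A * p k + B * q k + C * (u k - r * w k)) * y k =
        A * ∑ k, p k * y k + B * ∑ k, q k * y k + C * (∑ k, u k * y k - r * ∑ k, w k * y k) := by
    intro A B C r p q u w
    simp only [Finset.mul_sum, ← Finset.sum_sub_distrib, ← Finset.sum_add_distrib]
    exact Finset.sum_congr rfl fun k _ => by ring
  rw [← hamel_beta hU hb hx]
  simp only [hamel, key, derivX_alphaBeta hU ha hb hx hy hdf0, Pi.add_apply, Pi.smul_apply,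
    smul_eq_mul, gradY, ratioFlow, flowDeriv, e]
  ring

end Finsler

namespace Finsler

/-! Facts about functions of one variable. -/

theorem contDiffAt_deriv {f : ℝ → ℝ} {s : ℝ} (hf : ContDiffAt ℝ ∞ f s) :
    ContDiffAt ℝ ∞ (deriv f) s :=
  (hf.fderiv_right (m := ∞) (by simp)).clm_apply contDiffAt_const

/-- Mean value theorem for `h/g`, which vanishes at `0` but not at `r`. -/
theorem exists_wronskian_ne_zero {g h g' h' : ℝ → ℝ} {r : ℝ} (hr : 0 < r)
    (hg : ∀ s ∈ Set.Icc 0 r, HasDerivAt g (g' s) s) (hh : ∀ s ∈ Set.Icc 0 r, HasDerivAt h (h' s) s)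
    (hpos : ∀ s ∈ Set.Icc 0 r, 0 < g s) (h0 : h 0 = 0) (hne : h r ≠ 0) :
    ∃ s ∈ Set.Ioo 0 r, g s * h' s - g' s * h s ≠ 0 := by
  have hd : ∀ s ∈ Set.Icc 0 r, HasDerivAt (fun s => h s / g s)
      ((h' s * g s - h s * g' s) / g s ^ 2) s := fun s hs =>
    (hh s hs).div (hg s hs) (hpos s hs).ne'
  obtain ⟨c, hc, hc'⟩ := exists_hasDerivAt_eq_slope (fun s => h s / g s) _ hr
    (fun s hs => (hd s hs).continuousAt.continuousWithinAt)
    fun s hs => hd s (Set.Ioo_subset_Icc_self hs)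
  refine ⟨c, hc, fun hz => ?_⟩
  have e : h' c * g c - h c * g' c = 0 := by linarith
  rw [e, zero_div, h0, zero_div, sub_zero, sub_zero] at hc'
  have := (hpos r (Set.right_mem_Icc.2 hr.le)).ne'
  have : h r / g r / r ≠ 0 := div_ne_zero (div_ne_zero hne this) hr.ne'
  exact this hc'.symm

/-- Mean value theorem for `h(s)/s`, extended by `h' 0` at `s = 0` through `dslope`. -/
theorem exists_sub_mul_deriv_ne_zero {h h' : ℝ → ℝ} {r : ℝ} (hr : 0 < r)
    (hh : ∀ s ∈ Set.Icc 0 r, HasDerivAt h (h' s) s) (h0 : h 0 = 0) (hne : h r ≠ h' 0 * r) :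
    ∃ s ∈ Set.Ioo 0 r, h s - s * h' s ≠ 0 := by
  have hcont : ContinuousOn (dslope h 0) (Set.Icc 0 r) := by
    intro s hs
    refine ContinuousAt.continuousWithinAt ?_
    by_cases h : s = 0
    · subst h
      exact continuousAt_dslope_same.2 (hh 0 hs).differentiableAt
    · exact (continuousAt_dslope_of_ne h).2 (hh s hs).continuousAt
  have hd : ∀ s ∈ Set.Ioo 0 r, HasDerivAt (dslope h 0) ((h' s * s - h s * 1) / s ^ 2) s := by
    intro s hs
    have := (hh s (Set.Ioo_subset_Icc_self hs)).div (hasDerivAt_id' s) hs.1.ne'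
    refine this.congr_of_eventuallyEq ?_
    filter_upwards [isOpen_ne.mem_nhds hs.1.ne'] with t ht
    rw [dslope_of_ne _ ht, slope_def_field, h0, sub_zero, sub_zero]
    rfl
  obtain ⟨c, hc, hc'⟩ := exists_hasDerivAt_eq_slope _ _ hr hcont hd
  refine ⟨c, hc, fun hz => hne ?_⟩
  have e : h' c * c - h c * 1 = 0 := by linarith
  rw [e, zero_div, dslope_same, (hh 0 (Set.left_mem_Icc.2 hr.le)).deriv, dslope_of_ne _ hr.ne',
    slope_def_field, h0, sub_zero, sub_zero, eq_comm, div_eq_zero_iff, sub_eq_zero] at hc'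
  exact (div_eq_iff hr.ne').1 (hc'.resolve_right hr.ne')

/-! Linear algebra at a point. -/

variable {n : ℕ}

/-- Two linear conditions leave a nonzero solution as soon as the dimension is at least three. -/
theorem exists_ne_zero_orthogonal (hn : 3 ≤ n) (b c : Vec n) :
    ∃ w : Vec n, w ≠ 0 ∧ b ⬝ᵥ w = 0 ∧ c ⬝ᵥ w = 0 := by
  let f : Vec n →ₗ[ℝ] (Fin 2 → ℝ) := Matrix.mulVecLin (Matrix.of ![b, c])
  have hk : LinearMap.ker f ≠ ⊥ := LinearMap.ker_ne_bot_of_finrank_lt (by simp; omega)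
  obtain ⟨w, hw, hw0⟩ := Submodule.exists_mem_ne_zero_of_ne_bot hk
  have h : Matrix.of ![b, c] *ᵥ w = 0 := hw
  exact ⟨w, hw0, congrFun h 0, congrFun h 1⟩

section Point

variable {a : Matrix (Fin n) (Fin n) ℝ} {b u : Vec n}

theorem transpose_eq_of_posDef (ha : a.PosDef) : aᵀ = a := by
  rw [← Matrix.conjTranspose_eq_transpose_of_trivial]
  exact ha.1

/-- For a positive definite form and `|s| < ‖b‖` there are unit vectors `y` with `b(y) = s`
in the span of the dual vector `u` of `b` and any nonzero `w` in the kernel of `b`. -/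
theorem exists_unit_vector (ha : a.PosDef) (hu : a *ᵥ u = b) {s : ℝ} (hs0 : 0 < s)
    (hs : s ^ 2 < b ⬝ᵥ u) {w : Vec n} (hw : w ≠ 0) (hbw : b ⬝ᵥ w = 0) :
    ∃ p q : ℝ, p ≠ 0 ∧ q ≠ 0 ∧ ∀ e : ℝ, e ^ 2 = 1 →
      (p • u + (e * q) • w) ⬝ᵥ a *ᵥ (p • u + (e * q) • w) = 1 ∧
      b ⬝ᵥ (p • u + (e * q) • w) = s := by
  have hN : 0 < w ⬝ᵥ a *ᵥ w := by simpa using ha.dotProduct_mulVec_pos hw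
  have hB : 0 < b ⬝ᵥ u := lt_of_le_of_lt (sq_nonneg s) hs
  have hK : 0 < (1 - s ^ 2 / (b ⬝ᵥ u)) / (w ⬝ᵥ a *ᵥ w) := by
    refine div_pos ?_ hN
    rw [sub_pos, div_lt_one hB]; exact hs
  -- The coefficient of `u` is forced by `b(y) = s`. The coefficient of `w` then normalises the
  -- length, `u` and `w` being `a`-orthogonal, and its sign `e` stays free.
  refine ⟨s / (b ⬝ᵥ u), √((1 - s ^ 2 / (b ⬝ᵥ u)) / (w ⬝ᵥ a *ᵥ w)), (div_pos hs0 hB).ne',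
    (Real.sqrt_pos.2 hK).ne', fun e he => ?_⟩
  set q := √((1 - s ^ 2 / (b ⬝ᵥ u)) / (w ⬝ᵥ a *ᵥ w))
  have hq : q ^ 2 * (w ⬝ᵥ a *ᵥ w) = 1 - s ^ 2 / (b ⬝ᵥ u) := by
    rw [Real.sq_sqrt hK.le, div_mul_cancel₀ _ hN.ne']
  have hsym : u ⬝ᵥ a *ᵥ w = 0 := by
    rw [Matrix.dotProduct_mulVec, ← Matrix.mulVec_transpose,
      transpose_eq_of_posDef ha, hu, hbw]
  constructor
  · simp only [Matrix.mulVec_add, Matrix.mulVec_smul, add_dotProduct, dotProduct_add,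
      smul_dotProduct, dotProduct_smul, smul_eq_mul, hu, hsym, dotProduct_comm u b,
      dotProduct_comm w b, hbw]
    have : s / (b ⬝ᵥ u) * (s / (b ⬝ᵥ u) * (b ⬝ᵥ u)) = s ^ 2 / (b ⬝ᵥ u) := by
      field_simp
    linear_combination this + q ^ 2 * (w ⬝ᵥ a *ᵥ w) * he + hq
  · simp only [dotProduct_add, dotProduct_smul, smul_eq_mul, hbw]
    rw [div_mul_cancel₀ _ hB.ne']; ring

/-- Split space into the line of `u` and the kernel of `b`. For the mixed entries a suitable `w`
exists because `n ≥ 3`; within the kernel, the part of `v` along `w` can be dropped because `M` is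
skew. -/
theorem skew_eq_zero (hn : 3 ≤ n) (ha : a.PosDef) (hB : 0 < b ⬝ᵥ u)
    {M : Matrix (Fin n) (Fin n) ℝ} (hM : Mᵀ = -M)
    (h : ∀ w, w ≠ 0 → b ⬝ᵥ w = 0 → ∀ v, b ⬝ᵥ v = 0 → v ⬝ᵥ a *ᵥ w = 0 →
      v ⬝ᵥ M *ᵥ u = 0 ∧ v ⬝ᵥ M *ᵥ w = 0) : M = 0 := by
  have hskew : ∀ v w, v ⬝ᵥ M *ᵥ w = -(w ⬝ᵥ M *ᵥ v) := fun v w => by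
    rw [Matrix.dotProduct_mulVec, ← Matrix.mulVec_transpose, hM, Matrix.neg_mulVec, neg_dotProduct,
      dotProduct_comm]
  have hself : ∀ v, v ⬝ᵥ M *ᵥ v = 0 := fun v => by linarith [hskew v v]
  have h1 : ∀ v, b ⬝ᵥ v = 0 → v ⬝ᵥ M *ᵥ u = 0 := by
    intro v hv
    obtain ⟨w, hw, hbw, haw⟩ := exists_ne_zero_orthogonal hn b (a *ᵥ v)
    refine (h w hw hbw v hv ?_).1
    rw [Matrix.dotProduct_mulVec, ← Matrix.mulVec_transpose, transpose_eq_of_posDef ha, haw]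
  have h2 : ∀ v w, b ⬝ᵥ v = 0 → b ⬝ᵥ w = 0 → v ⬝ᵥ M *ᵥ w = 0 := by
    intro v w hv hw
    by_cases hw0 : w = 0
    · rw [hw0, Matrix.mulVec_zero, dotProduct_zero]
    have hN : 0 < w ⬝ᵥ a *ᵥ w := by simpa using ha.dotProduct_mulVec_pos hw0
    set c := (v ⬝ᵥ a *ᵥ w) / (w ⬝ᵥ a *ᵥ w)
    have := (h w hw0 hw (v - c • w) (by simp [dotProduct_sub, hv, hw])
      (by rw [sub_dotProduct, smul_dotProduct, smul_eq_mul, div_mul_cancel₀ _ hN.ne', sub_self])).2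
    rwa [sub_dotProduct, smul_dotProduct, hself, smul_zero, sub_zero] at this
  have h3 : ∀ v w, v ⬝ᵥ M *ᵥ w = 0 := by
    intro v w
    have key : ∀ v : Vec n, ∃ (c : ℝ) (v' : Vec n), v = c • u + v' ∧ b ⬝ᵥ v' = 0 := fun v =>
      ⟨(b ⬝ᵥ v) / (b ⬝ᵥ u), v - ((b ⬝ᵥ v) / (b ⬝ᵥ u)) • u, by abel, by
        rw [dotProduct_sub, dotProduct_smul, smul_eq_mul, div_mul_cancel₀ _ hB.ne', sub_self]⟩
    obtain ⟨c, v', rfl, hv'⟩ := key v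
    obtain ⟨d, w', rfl, hw'⟩ := key w
    simp only [Matrix.mulVec_add, Matrix.mulVec_smul, add_dotProduct, dotProduct_add,
      smul_dotProduct, dotProduct_smul, hself, h1 v' hv', hskew u w', h1 w' hw', h2 v' w' hv' hw']
    simp
  ext i j
  simpa using h3 (Pi.single i 1) (Pi.single j 1)

/-- The pointwise rigidity behind the theorem: if the Hamel equations hold for an even function `g`
and for an odd function `h` that is not linear, then all their coefficients vanish. -/
theorem coefficients_eq_zero (hn : 3 ≤ n) (ha : a.PosDef) (hu : a *ᵥ u = b)
    {M : Matrix (Fin n) (Fin n) ℝ} (hM : Mᵀ = -M) {A S : Vec n → Vec n} {T Q σ : Vec n → ℝ}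
    {g h : ℝ → ℝ} (hσ : ∀ y, σ y = (b ⬝ᵥ y) / √(y ⬝ᵥ a *ᵥ y))
    (hS : ∀ y, y ≠ 0 → √(y ⬝ᵥ a *ᵥ y) • S y = b - (σ y / √(y ⬝ᵥ a *ᵥ y)) • a *ᵥ y)
    (hQ : AnalyticOnNhd ℝ Q Set.univ) (hTQ : ∀ y, y ≠ 0 → (y ⬝ᵥ a *ᵥ y) * T y = Q y)
    (hσB : ∀ y, y ≠ 0 → σ y ^ 2 ≤ b ⬝ᵥ u)
    (hg : ∀ s, s ^ 2 ≤ b ⬝ᵥ u → ContDiffAt ℝ ∞ g s)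
    (hh : ∀ s, s ^ 2 ≤ b ⬝ᵥ u → ContDiffAt ℝ ∞ h s)
    (hgpos : ∀ s, s ^ 2 ≤ b ⬝ᵥ u → 0 < g s)
    (hgpos' : ∀ s, s ^ 2 ≤ b ⬝ᵥ u → 0 < g s - s * deriv g s)
    (h0 : h 0 = 0) {r : ℝ} (hr : 0 < r) (hrB : r ^ 2 < b ⬝ᵥ u) (hne : h r ≠ deriv h 0 * r)
    (e1 : ∀ y, y ≠ 0 → (g (σ y) - σ y * deriv g (σ y)) • A y + deriv g (σ y) • M *ᵥ y +
      (deriv (deriv g) (σ y) * T y) • S y = 0)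
    (e2 : ∀ y, y ≠ 0 → (h (σ y) - σ y * deriv h (σ y)) • A y + deriv h (σ y) • M *ᵥ y +
      (deriv (deriv h) (σ y) * T y) • S y = 0) :
    M = 0 ∧ ∀ y, y ≠ 0 → T y = 0 ∧ A y = 0 := by
  have hB : 0 < b ⬝ᵥ u := lt_of_le_of_lt (sq_nonneg r) hrB
  have hsq : ∀ s ∈ Set.Icc 0 r, s ^ 2 < b ⬝ᵥ u := fun s hs =>
    lt_of_le_of_lt (pow_le_pow_left₀ hs.1 hs.2 2) hrB
  have hD : ∀ f : ℝ → ℝ, (∀ s, s ^ 2 ≤ b ⬝ᵥ u → ContDiffAt ℝ ∞ f s) → ∀ s, s ^ 2 ≤ b ⬝ᵥ u →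
      HasDerivAt f (deriv f s) s ∧ HasDerivAt (deriv f) (deriv (deriv f) s) s ∧
      ContinuousAt (deriv (deriv f)) s := by
    intro f hf s hs
    have c1 : ContDiffAt ℝ ∞ (deriv f) s := contDiffAt_deriv (hf s hs)
    have c2 : ContDiffAt ℝ ∞ (deriv (deriv f)) s := contDiffAt_deriv c1
    exact ⟨((hf s hs).differentiableAt (by simp)).hasDerivAt,
      (c1.differentiableAt (by simp)).hasDerivAt, c2.continuousAt⟩
  have hDg := hD g hg
  have hDh := hD h hh
  have hpos : ∀ y, y ≠ 0 → 0 < y ⬝ᵥ a *ᵥ y := fun y hy => by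
    simpa using ha.dotProduct_mulVec_pos hy
  have hunit : ∀ y, y ⬝ᵥ a *ᵥ y = 1 → y ≠ 0 := by
    rintro y hy rfl
    simp at hy
  -- a point where `h - s h'` does not vanish
  obtain ⟨r₁, hr₁, hp₁⟩ := exists_sub_mul_deriv_ne_zero (h' := deriv h) hr
    (fun s hs => (hDh s (hsq s hs).le).1) h0 hne
  have hsub₁ : Set.Icc 0 r₁ ⊆ Set.Icc 0 r := Set.Icc_subset_Icc_right hr₁.2.le
  -- If `h` vanished on the whole interval, so would `h - s h'`, contrary to the choice of `r₁`.
  obtain ⟨r₂, hr₂, hp₂⟩ : ∃ s ∈ Set.Ioo 0 r, h s ≠ 0 := by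
    by_contra! hcon
    refine hp₁ ?_
    have : h =ᶠ[nhds r₁] fun _ => 0 := by
      filter_upwards [Ioo_mem_nhds hr₁.1 hr₁.2] with t ht using hcon t ht
    rw [this.deriv_eq, this.eq_of_nhds]
    simp
  have hsub₂ : Set.Icc 0 r₂ ⊆ Set.Icc 0 r := Set.Icc_subset_Icc_right hr₂.2.le
  -- the coefficient of `b` vanishes
  have hM0 : M = 0 := by
    obtain ⟨s, hs, hW⟩ := exists_wronskian_ne_zero (g := g) (h := h) hr₂.1
      (fun s hs => (hDg s (hsq s (hsub₂ hs)).le).1) (fun s hs => (hDh s (hsq s (hsub₂ hs)).le).1)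
      (fun s hs => hgpos s (hsq s (hsub₂ hs)).le) h0 hp₂
    refine skew_eq_zero hn ha hB hM fun w hw hbw v hbv hvw => ?_
    obtain ⟨p, q, hp, hq, hpq⟩ := exists_unit_vector ha hu hs.1
      (hsq s (hsub₂ (Set.Ioo_subset_Icc_self hs))) hw hbw
    -- A covector `v` orthogonal to `b` and `a`-orthogonal to `w` kills `S`. The two equations then
    -- form a linear system in `v · A` and `v · M y`, with determinant `(g - s g') h' - (h - s h')
    -- g' = g h' - g' h`.
    have key : ∀ e : ℝ, e ^ 2 = 1 → v ⬝ᵥ M *ᵥ (p • u + (e * q) • w) = 0 := by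
      intro e he
      obtain ⟨k1, k2⟩ := hpq e he
      set y := p • u + (e * q) • w with hy
      have hy0 := hunit y k1
      have hσy : σ y = s := by rw [hσ, k1, k2, Real.sqrt_one, div_one]
      have hvS : v ⬝ᵥ S y = 0 := by
        have h3 := hS y hy0
        rw [k1, Real.sqrt_one, one_smul, div_one] at h3
        rw [h3, dotProduct_sub, dotProduct_smul, dotProduct_comm v b, hbv, hy, Matrix.mulVec_add,
          Matrix.mulVec_smul, Matrix.mulVec_smul, hu, dotProduct_add, dotProduct_smul,
          dotProduct_smul, hvw, dotProduct_comm v b, hbv]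
        simp
      have k3 := congrArg (v ⬝ᵥ ·) (e1 y hy0)
      have k4 := congrArg (v ⬝ᵥ ·) (e2 y hy0)
      simp only [dotProduct_add, dotProduct_smul, hvS, dotProduct_zero, smul_eq_mul, mul_zero,
        add_zero, hσy] at k3 k4
      refine (mul_eq_zero.1 ?_).resolve_left hW
      linear_combination (g s - s * deriv g s) * k4 - (h s - s * deriv h s) * k3
    -- The two signs of the `w` component separate `M u` from `M w`.
    have k1 := key 1 (by norm_num)
    have k2 := key (-1) (by norm_num)
    simp only [Matrix.mulVec_add, Matrix.mulVec_smul, dotProduct_add, dotProduct_smul,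
      smul_eq_mul] at k1 k2
    constructor
    · refine (mul_eq_zero.1 (?_ : p * (v ⬝ᵥ M *ᵥ u) = 0)).resolve_left hp
      linear_combination (k1 + k2) / 2
    · refine (mul_eq_zero.1 (?_ : q * (v ⬝ᵥ M *ᵥ w) = 0)).resolve_left hq
      linear_combination (k1 - k2) / 2
  refine ⟨hM0, ?_⟩
  -- the function `T` vanishes on an open set
  set D : ℝ → ℝ := fun s => (g s - s * deriv g s) * deriv (deriv h) s -
    deriv (deriv g) s * (h s - s * deriv h s) with hDdef
  -- Paired with `u`, the equations involve only `A · u` and `T (S · u)`, with determinant `D`. Here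
  -- `S · u = (b · u - σ²)/α` is nonzero away from the extreme values of `σ`.
  have hDT : ∀ y, y ≠ 0 → σ y ^ 2 < b ⬝ᵥ u → D (σ y) ≠ 0 → T y = 0 := by
    intro y hy hlt hDy
    have hα := Real.sqrt_pos.2 (hpos y hy)
    have hαsq := Real.sq_sqrt (hpos y hy).le
    set α := √(y ⬝ᵥ a *ᵥ y)
    have hb : b ⬝ᵥ y = σ y * α := by rw [hσ, div_mul_cancel₀ _ hα.ne']
    have hSu : S y ⬝ᵥ u ≠ 0 := by
      have h3 := congrArg (· ⬝ᵥ u) (hS y hy)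
      have h4 : (a *ᵥ y) ⬝ᵥ u = b ⬝ᵥ y := by
        rw [dotProduct_comm, Matrix.dotProduct_mulVec, ← Matrix.mulVec_transpose,
          transpose_eq_of_posDef ha, hu]
      simp only [smul_dotProduct, sub_dotProduct, smul_eq_mul, h4, hb] at h3
      intro h5
      rw [h5, mul_zero] at h3
      have : σ y / α * (σ y * α) = σ y ^ 2 := by field_simp
      linarith
    have k1 := congrArg (· ⬝ᵥ u) (e1 y hy)
    have k2 := congrArg (· ⬝ᵥ u) (e2 y hy)
    simp only [hM0, Matrix.zero_mulVec, smul_zero, add_zero, add_dotProduct, smul_dotProduct,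
      smul_eq_mul, zero_dotProduct] at k1 k2
    have k3 : D (σ y) * (S y ⬝ᵥ u) * T y = 0 := by
      simp only [hDdef]
      linear_combination (g (σ y) - σ y * deriv g (σ y)) * k2 -
        (h (σ y) - σ y * deriv h (σ y)) * k1
    exact (mul_eq_zero.1 k3).resolve_left (mul_ne_zero hDy hSu)
  -- The Wronskian of `g - s g'` and `h - s h'` is `-s D`, so `D` is nonzero at some interior `s`.
  obtain ⟨s, hs, hW⟩ := exists_wronskian_ne_zero (g := fun s => g s - s * deriv g s)
    (h := fun s => h s - s * deriv h s) (g' := fun s => -(s * deriv (deriv g) s))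
    (h' := fun s => -(s * deriv (deriv h) s)) hr₁.1
    (fun s hs => by
      obtain ⟨d1, d2, -⟩ := hDg s (hsq s (hsub₁ hs)).le
      exact (d1.sub ((hasDerivAt_id' s).mul d2)).congr_deriv (by ring))
    (fun s hs => by
      obtain ⟨d1, d2, -⟩ := hDh s (hsq s (hsub₁ hs)).le
      exact (d1.sub ((hasDerivAt_id' s).mul d2)).congr_deriv (by ring))
    (fun s hs => hgpos' s (hsq s (hsub₁ hs)).le) (by simp [h0]) hp₁
  have hsB := hsq s (hsub₁ (Set.Ioo_subset_Icc_self hs))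
  have hDs : D s ≠ 0 := by
    intro h3
    refine hW ?_
    simp only [hDdef] at h3
    linear_combination -s * h3
  obtain ⟨w, hw, hbw, -⟩ := exists_ne_zero_orthogonal hn b b
  obtain ⟨p, q, -, -, hpq⟩ := exists_unit_vector ha hu hs.1 hsB hw hbw
  obtain ⟨k1, k2⟩ := hpq 1 (by norm_num)
  set y₀ := p • u + (1 * q) • w
  have hy₀ := hunit y₀ k1
  have hσ₀ : σ y₀ = s := by rw [hσ, k1, k2, Real.sqrt_one, div_one]
  have hσc : ContinuousAt σ y₀ := by
    rw [show σ = fun y => (b ⬝ᵥ y) / √(y ⬝ᵥ a *ᵥ y) from funext hσ]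
    refine ContinuousAt.div ?_ ?_ (by rw [k1]; simp)
    · exact Continuous.continuousAt (by fun_prop)
    · exact Continuous.continuousAt (by fun_prop)
  have hDc : ContinuousAt D s := by
    obtain ⟨d1, d2, d3⟩ := hDg s hsB.le
    obtain ⟨d4, d5, d6⟩ := hDh s hsB.le
    have := d1.continuousAt
    have := d2.continuousAt
    have := d4.continuousAt
    have := d5.continuousAt
    fun_prop
  have hQ0 : Q =ᶠ[nhds y₀] 0 := by
    have v1 : ∀ᶠ y in nhds y₀, D (σ y) ≠ 0 := by
      have : ContinuousAt (fun y => D (σ y)) y₀ :=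
        ContinuousAt.comp (g := D) (by rw [hσ₀]; exact hDc) hσc
      exact this.eventually_ne (by rw [hσ₀]; exact hDs)
    have v2 : ∀ᶠ y in nhds y₀, σ y ^ 2 < b ⬝ᵥ u :=
      (hσc.pow 2).eventually (gt_mem_nhds (by rw [Pi.pow_apply, hσ₀]; exact hsB))
    filter_upwards [v1, v2, isOpen_ne.mem_nhds hy₀] with y h1 h2 h3
    rw [← hTQ y h3, hDT y h3 h2 h1, mul_zero]
    rfl
  -- Identity theorem: the analytic function `Q` vanishes near `y₀`, hence everywhere. This gives `T
  -- = 0` even where `D` vanishes.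
  have hQz : Q = 0 := hQ.eq_of_eventuallyEq (fun _ _ => analyticAt_const) hQ0
  intro y hy
  have hT : T y = 0 := by
    have := hTQ y hy
    rw [hQz] at this
    exact (mul_eq_zero.1 this).resolve_left (hpos y hy).ne'
  refine ⟨hT, ?_⟩
  have h3 := e1 y hy
  rw [hT, hM0, mul_zero, zero_smul, Matrix.zero_mulVec, smul_zero, add_zero, add_zero] at h3
  exact (smul_eq_zero.1 h3).resolve_left (hgpos' _ (hσB y hy)).ne'

end Point

end Finsler

namespace Finsler

variable {n : ℕ} {U : Set (Vec n)} {a : Vec n → Matrix (Fin n) (Fin n) ℝ} {b : Vec n → Vec n}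
  {f : ℝ → ℝ} {x y : Vec n}

/-! The Riemannian metric `α` as a Finsler metric. -/

theorem fundTensor_alpha (hU : IsOpen U) (ha : IsRiemannianMetric U a) (hx : x ∈ U)
    (hy : y ≠ 0) : fundTensor (alpha a) x y = a x := by
  ext i j
  have h1 : ∀ x y, (x, y) ∈ slit U → derivY i (sqr (alpha a)) x y =
      beta (fun x => (2 : ℝ) • a x i) x y := fun x y h => by
    rw [derivY_congr (isOpen_slit hU) (fun x y h => sqr_alpha ha h.1 y) i h,
      derivY_quad (matrix_symm ha h.1), beta, smul_dotProduct]
    rfl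
  rw [fundTensor, Matrix.of_apply, derivY_congr (isOpen_slit hU) h1 j (mk_mem_slit hx hy),
    derivY_beta]
  simp

theorem isFinslerMetric_alpha (hU : IsOpen U) (ha : IsRiemannianMetric U a) :
    IsFinslerMetric U (alpha a) where
  continuousOn := ContinuousOn.sqrt (ContDiffOn.continuousOn (smoothOn_quad ha Set.univ))
  nonneg _ _ _ := Real.sqrt_nonneg _
  smooth := smoothOn_alpha ha
  homogeneous x _ y c hc := by rw [alpha_smul, abs_of_pos hc]
  stronglyConvex x hx y hy := by rw [fundTensor_alpha hU ha hx hy]; exact ha.2 x hx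

theorem hamel_quad (hU : IsOpen U) (ha : IsRiemannianMetric U a) (hx : x ∈ U) (l : Fin n) :
    hamel (quad a) x y l = ∑ i, ∑ j, (matDeriv i a x l j + matDeriv j a x l i -
      matDeriv l a x i j) * (y i * y j) := by
  have hW : IsOpen (U ×ˢ (Set.univ : Set (Vec n))) := hU.prod isOpen_univ
  have e : ∀ k, derivY l (derivX k (quad a)) x y = 2 * (matDeriv k a x *ᵥ y) l := fun k => by
    rw [derivY_congr hW (fun x y h => derivX_quad hU ha h.1 k) l (x := x) (y := y) ⟨hx, trivial⟩,
      derivY_quad (matDeriv_symm hU ha hx k)]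
  simp only [hamel, e, derivX_quad hU ha hx, quad_eq_sum, sub_mul, add_mul,
    Finset.sum_sub_distrib, Finset.sum_add_distrib]
  congr 1
  rw [Finset.sum_comm (f := fun i j => matDeriv j a x l i * (y i * y j)), ← Finset.sum_add_distrib]
  refine Finset.sum_congr rfl fun i _ => ?_
  rw [← Finset.sum_add_distrib, Matrix.mulVec, dotProduct, Finset.mul_sum, Finset.sum_mul]
  exact Finset.sum_congr rfl fun j _ => by ring

theorem spray_alpha (hU : IsOpen U) (ha : IsRiemannianMetric U a) (hx : x ∈ U) (hy : y ≠ 0) :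
    spray (alpha a) x y = (1 / 4 : ℝ) • ((a x)⁻¹ *ᵥ hamel (quad a) x y) := by
  rw [spray_eq, fundTensor_alpha hU ha hx hy, hamel_congr (isOpen_slit hU)
    (fun x y h => sqr_alpha ha h.1 y) (mk_mem_slit hx hy)]

/-- The vector dual to the `1`-form `b`. -/
noncomputable def dual (a : Vec n → Matrix (Fin n) (Fin n) ℝ) (b : Vec n → Vec n)
    (x : Vec n) : Vec n := (a x)⁻¹ *ᵥ b x

theorem isUnit_det_of_riemannian (ha : IsRiemannianMetric U a) (hx : x ∈ U) :
    IsUnit (a x).det := (Matrix.isUnit_iff_isUnit_det _).1 (ha.2 x hx).isUnit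

theorem mulVec_dual (ha : IsRiemannianMetric U a) (hx : x ∈ U) : a x *ᵥ dual a b x = b x := by
  rw [dual, Matrix.mulVec_mulVec, Matrix.mul_nonsing_inv _ (isUnit_det_of_riemannian ha hx),
    Matrix.one_mulVec]

theorem dotProduct_inv_mulVec (ha : IsRiemannianMetric U a) (hx : x ∈ U) (w : Vec n) :
    b x ⬝ᵥ (a x)⁻¹ *ᵥ w = dual a b x ⬝ᵥ w := by
  rw [Matrix.dotProduct_mulVec, ← Matrix.mulVec_transpose, Matrix.transpose_nonsing_inv,
    transpose_eq_of_posDef (ha.2 x hx), dual]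

theorem sum_mul_christoffel (ha : IsRiemannianMetric U a) (hx : x ∈ U) (i j : Fin n) :
    ∑ k, b x k * christoffel a k i j x = 1 / 2 * ∑ l, dual a b x l *
      (matDeriv i a x l j + matDeriv j a x l i - matDeriv l a x i j) := by
  have h := dotProduct_inv_mulVec (b := b) ha hx fun l =>
    matDeriv i a x l j + matDeriv j a x l i - matDeriv l a x i j
  simp only [dotProduct, Matrix.mulVec] at h
  rw [← h, Finset.mul_sum]
  refine Finset.sum_congr rfl fun k _ => ?_
  simp only [christoffel, matDeriv, Matrix.of_apply]
  ring

theorem christoffel_symm (hU : IsOpen U) (ha : IsRiemannianMetric U a) (hx : x ∈ U)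
    (k i j : Fin n) : christoffel a k i j x = christoffel a k j i x := by
  simp only [christoffel]
  congr 1
  refine Finset.sum_congr rfl fun l _ => ?_
  have := matDeriv_symm hU ha hx l i j
  simp only [matDeriv, Matrix.of_apply] at this
  rw [this]; ring

/-- If `α` satisfies the Hamel equations at `x`, the symmetric part of the covariant derivative of
`β` is given by `ratioFlow`. -/
theorem sum_covDeriv_mul (hU : IsOpen U) (ha : IsRiemannianMetric U a) (hb : IsOneForm U b)
    (hx : x ∈ U) (hy : y ≠ 0) (h : hamel (alpha a) x y = 0) :
    ∑ i, ∑ j, covDeriv a b i j x * (y i * y j) = ratioFlow a b x y := by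
  -- The spray of `α` is radial. Contracting it with `b` turns the Christoffel term of the covariant
  -- derivative into `(β/α)` times the flow derivative of `α`.
  have h1 := (isFinslerMetric_alpha hU ha).spray_of_hamel hU hx hy h
  rw [spray_alpha hU ha hx hy] at h1
  have h2 := congrArg (b x ⬝ᵥ ·) h1
  simp only [dotProduct_smul, dotProduct_inv_mulVec ha hx, smul_eq_mul] at h2
  have h3 : ∑ i, ∑ j, (∑ k, b x k * christoffel a k i j x) * (y i * y j) =
      1 / 2 * (dual a b x ⬝ᵥ hamel (quad a) x y) := by
    simp only [sum_mul_christoffel ha hx, dotProduct, hamel_quad hU ha hx, Finset.mul_sum,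
      Finset.sum_mul]
    rw [Finset.sum_comm' (t' := Finset.univ) (s' := fun _ => Finset.univ) (by simp)]
    have : ∀ g : Fin n → Fin n → Fin n → ℝ,
        ∑ j, ∑ i, ∑ l, g i j l = ∑ l, ∑ i, ∑ j, g i j l := by
      intro g
      rw [Finset.sum_comm]
      rw [Finset.sum_congr rfl fun i _ => Finset.sum_comm]
      exact Finset.sum_comm
    rw [this]
    exact Finset.sum_congr rfl fun l _ => Finset.sum_congr rfl fun i _ =>
      Finset.sum_congr rfl fun j _ => by ring
  have h4 : ∑ i, ∑ j, pderiv j (fun z => b z i) x * (y i * y j) = flowDeriv (beta b) x y := by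
    simp only [flowDeriv, derivX_beta hU hb hx, Finset.sum_mul]
    rw [Finset.sum_comm]
    exact Finset.sum_congr rfl fun l _ => Finset.sum_congr rfl fun i _ => by ring
  simp only [covDeriv, sub_mul, Finset.sum_sub_distrib]
  rw [h3, h4, ratioFlow]
  have h5 : b x ⬝ᵥ y = ratio a b x y * alpha a x y := (ratio_mul_alpha ha hx hy).symm
  have hα := (alpha_pos ha hx hy).ne'
  rw [h5] at h2
  have h6 : flowDeriv (alpha a) x y / (2 * alpha a x y) * (ratio a b x y * alpha a x y) =
      1 / 2 * (ratio a b x y * flowDeriv (alpha a) x y) := by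
    field_simp
  linarith

/-- Closedness of `β` makes the covariant derivative symmetric. Its quadratic form is `ratioFlow`,
which vanishes, and polarisation finishes. -/
theorem covDeriv_eq_zero (hU : IsOpen U) (ha : IsRiemannianMetric U a) (hb : IsOneForm U b)
    (hx : x ∈ U) (hcurl : curl b x = 0)
    (h : ∀ y, y ≠ 0 → ratioFlow a b x y = 0 ∧ hamel (alpha a) x y = 0) (i j : Fin n) :
    covDeriv a b i j x = 0 := by
  set C : Matrix (Fin n) (Fin n) ℝ := Matrix.of fun i j => covDeriv a b i j x with hC
  have hsymm : Cᵀ = C := by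
    ext i j
    have := congrFun (congrFun hcurl i) j
    simp only [curl, Matrix.of_apply, Matrix.zero_apply, sub_eq_zero] at this
    simp only [hC, Matrix.transpose_apply, Matrix.of_apply, covDeriv, this,
      fun k => christoffel_symm hU ha hx k i j]
  have hself : ∀ y, y ⬝ᵥ C *ᵥ y = 0 := by
    intro y
    by_cases hy : y = 0
    · simp [hy]
    · obtain ⟨h1, h2⟩ := h y hy
      rw [← h1, ← sum_covDeriv_mul hU ha hb hx hy h2]
      exact quad_eq_sum (fun _ => C) x y
  have hz : ∀ v w, v ⬝ᵥ C *ᵥ w = 0 := by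
    intro v w
    have h1 := hself (v + w)
    have h2 : w ⬝ᵥ C *ᵥ v = v ⬝ᵥ C *ᵥ w := by
      rw [Matrix.dotProduct_mulVec, ← Matrix.mulVec_transpose, hsymm, dotProduct_comm]
    simp only [Matrix.mulVec_add, add_dotProduct, dotProduct_add, hself, h2] at h1
    linarith
  simpa [hC] using hz (Pi.single i 1) (Pi.single j 1)

/-! The norm of `β`. -/

/-- The square of `formNorm`. -/
noncomputable def normSq (a : Vec n → Matrix (Fin n) (Fin n) ℝ) (b : Vec n → Vec n)
    (x : Vec n) : ℝ := b x ⬝ᵥ dual a b x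

theorem normSq_eq (ha : IsRiemannianMetric U a) (hx : x ∈ U) :
    normSq a b x = quad a x (dual a b x) := by
  rw [quad, mulVec_dual ha hx, normSq, dotProduct_comm]

/-- Cauchy-Schwarz, from the discriminant of the nonnegative quadratic `t ↦ quad a x (y - t • dual a
b x)`. -/
theorem beta_sq_le (ha : IsRiemannianMetric U a) (hx : x ∈ U) (y : Vec n) :
    beta b x y ^ 2 ≤ normSq a b x * quad a x y := by
  have hsym : y ⬝ᵥ b x = beta b x y := dotProduct_comm _ _
  have hsym' : dual a b x ⬝ᵥ a x *ᵥ y = beta b x y := by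
    rw [Matrix.dotProduct_mulVec, ← Matrix.mulVec_transpose, transpose_eq_of_posDef (ha.2 x hx),
      mulVec_dual ha hx, beta]
  have key : ∀ t : ℝ, 0 ≤ normSq a b x * (t * t) + (-2 * beta b x y) * t + quad a x y := by
    intro t
    have h := quad_nonneg ha hx (y - t • dual a b x)
    have e : quad a x (y - t • dual a b x) =
        normSq a b x * (t * t) + (-2 * beta b x y) * t + quad a x y := by
      simp only [quad, normSq, Matrix.mulVec_sub, Matrix.mulVec_smul, mulVec_dual ha hx,
        sub_dotProduct, dotProduct_sub, smul_dotProduct, dotProduct_smul, hsym, hsym', smul_eq_mul,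
        dotProduct_comm (dual a b x) (b x)]
      ring
    rwa [e] at h
  have := discrim_le_zero key
  rw [discrim] at this
  linarith

theorem ratio_sq_le (ha : IsRiemannianMetric U a) (hx : x ∈ U) (hy : y ≠ 0) :
    ratio a b x y ^ 2 ≤ normSq a b x := by
  have h1 := sqr_alpha ha hx y
  rw [ratio, div_pow, show alpha a x y ^ 2 = quad a x y from h1, div_le_iff₀ (quad_pos ha hx hy)]
  exact beta_sq_le ha hx y

theorem differentiableAt_dual (hU : IsOpen U) (ha : IsRiemannianMetric U a) (hb : IsOneForm U b)
    (hx : x ∈ U) (i : Fin n) : DifferentiableAt ℝ (fun z => dual a b z i) x := by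
  simp only [dual, Matrix.mulVec, dotProduct]
  refine DifferentiableAt.fun_sum fun j _ => DifferentiableAt.fun_mul ?_
    (differentiableAt_of_oneForm hU hb hx j)
  exact (contDiffAt_inv (m := ∞) (fun i j => (ha.1 i j).contDiffAt (hU.mem_nhds hx))
    (isUnit_det_of_riemannian ha hx).ne_zero i j).differentiableAt (by simp)

theorem differentiableAt_normSq (hU : IsOpen U) (ha : IsRiemannianMetric U a)
    (hb : IsOneForm U b) (hx : x ∈ U) : DifferentiableAt ℝ (normSq a b) x := by
  have : normSq a b = fun z => ∑ i, b z i * dual a b z i := rfl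
  rw [this]
  exact DifferentiableAt.fun_sum fun i _ => DifferentiableAt.fun_mul
    (differentiableAt_of_oneForm hU hb hx i) (differentiableAt_dual hU ha hb hx i)

/-- With `u` dual to `b`, the squared norm is both `b · u` and `a(u, u)`. Twice the derivative of
the first minus that of the second eliminates the derivative of `u`, so the inverse matrix need not
be differentiated explicitly. -/
theorem pderiv_normSq (hU : IsOpen U) (ha : IsRiemannianMetric U a) (hb : IsOneForm U b)
    (hx : x ∈ U) (k : Fin n) : pderiv k (normSq a b) x =
      2 * ∑ i, pderiv k (fun z => b z i) x * dual a b x i - quad (matDeriv k a) x (dual a b x) := by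
  have db := differentiableAt_of_oneForm hU hb hx
  have du := differentiableAt_dual hU ha hb hx
  have da := differentiableAt_of_riemannian hU ha hx
  have h1 : pderiv k (normSq a b) x = ∑ i, pderiv k (fun z => b z i) x * dual a b x i +
      ∑ i, b x i * pderiv k (fun z => dual a b z i) x := by
    change pderiv k (fun z => ∑ i, b z i * dual a b z i) x = _
    rw [pderiv_sum fun i _ => (db i).fun_mul (du i), ← Finset.sum_add_distrib]
    exact Finset.sum_congr rfl fun i _ => by rw [pderiv_mul (db i) (du i)]; ring
  have h2 : pderiv k (normSq a b) x = quad (matDeriv k a) x (dual a b x) +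
      2 * ∑ i, b x i * pderiv k (fun z => dual a b z i) x := by
    have e : normSq a b =ᶠ[nhds x] fun z => ∑ i, ∑ j, a z i j * (dual a b z i * dual a b z j) :=
      (hU.eventually_mem hx).mono fun z hz => by rw [normSq_eq ha hz, quad_eq_sum]
    have d2 : ∀ i j, DifferentiableAt ℝ (fun z => a z i j * (dual a b z i * dual a b z j)) x :=
      fun i j => (da i j).fun_mul ((du i).fun_mul (du j))
    rw [pderiv_congr e, pderiv_sum fun i _ => DifferentiableAt.fun_sum fun j _ => d2 i j,
      quad_eq_sum]
    have e2 : ∀ i, b x i = ∑ j, a x i j * dual a b x j := fun i =>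
      (congrFun (mulVec_dual ha hx) i).symm
    have e3 : ∑ i, b x i * pderiv k (fun z => dual a b z i) x =
        ∑ i, ∑ j, a x i j * (dual a b x i * pderiv k (fun z => dual a b z j) x) := by
      rw [Finset.sum_comm]
      refine Finset.sum_congr rfl fun i _ => ?_
      rw [e2 i, Finset.sum_mul]
      exact Finset.sum_congr rfl fun j _ => by rw [matrix_symm ha hx i j]; ring
    have e4 : ∑ i, b x i * pderiv k (fun z => dual a b z i) x =
        ∑ i, ∑ j, a x i j * (dual a b x j * pderiv k (fun z => dual a b z i) x) := by
      refine Finset.sum_congr rfl fun i _ => ?_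
      rw [e2 i, Finset.sum_mul]
      exact Finset.sum_congr rfl fun j _ => by ring
    rw [two_mul]
    nth_rewrite 1 [e3]
    rw [e4, ← Finset.sum_add_distrib, ← Finset.sum_add_distrib]
    refine Finset.sum_congr rfl fun i _ => ?_
    rw [pderiv_sum fun j _ => d2 i j, ← Finset.sum_add_distrib, ← Finset.sum_add_distrib]
    refine Finset.sum_congr rfl fun j _ => ?_
    rw [pderiv_mul (da i j) ((du i).fun_mul (du j)), pderiv_mul (du i) (du j), matDeriv,
      Matrix.of_apply]
    ring
  linarith

theorem fderiv_normSq_eq_zero (hU : IsOpen U) (ha : IsRiemannianMetric U a) (hb : IsOneForm U b)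
    (hx : x ∈ U) (h : ∀ i j, covDeriv a b i j x = 0) : fderiv ℝ (normSq a b) x = 0 := by
  have key : ∀ k, pderiv k (normSq a b) x = 0 := by
    intro k
    rw [pderiv_normSq hU ha hb hx, quad_eq_sum]
    have e : ∀ i, pderiv k (fun z => b z i) x = 1 / 2 * ∑ l, dual a b x l *
        (matDeriv i a x l k + matDeriv k a x l i - matDeriv l a x i k) := fun i => by
      rw [← sum_mul_christoffel ha hx, ← sub_eq_zero]
      exact h i k
    have e1 : ∑ i, ∑ l, matDeriv i a x l k * (dual a b x i * dual a b x l) =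
        ∑ i, ∑ l, matDeriv l a x i k * (dual a b x i * dual a b x l) := by
      rw [Finset.sum_comm]
      exact Finset.sum_congr rfl fun i _ => Finset.sum_congr rfl fun j _ => by ring
    have e2 : ∑ i, ∑ l, matDeriv k a x i l * (dual a b x i * dual a b x l) =
        ∑ i, ∑ l, matDeriv k a x l i * (dual a b x i * dual a b x l) :=
      Finset.sum_congr rfl fun i _ => Finset.sum_congr rfl fun j _ => by
        rw [matDeriv_symm hU ha hx]
    have e3 : 2 * ∑ i, pderiv k (fun z => b z i) x * dual a b x i =
        ∑ i, ∑ l, matDeriv i a x l k * (dual a b x i * dual a b x l) +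
        ∑ i, ∑ l, matDeriv k a x l i * (dual a b x i * dual a b x l) -
        ∑ i, ∑ l, matDeriv l a x i k * (dual a b x i * dual a b x l) := by
      rw [Finset.mul_sum, ← Finset.sum_add_distrib, ← Finset.sum_sub_distrib]
      refine Finset.sum_congr rfl fun i _ => ?_
      rw [e i, Finset.mul_sum, Finset.sum_mul, Finset.mul_sum, ← Finset.sum_add_distrib,
        ← Finset.sum_sub_distrib]
      exact Finset.sum_congr rfl fun l _ => by ring
    rw [e3, e1, e2]; ring
  ext v
  rw [← sum_pderiv_mul]
  simp [key]

end Finsler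

namespace Finsler

variable {n : ℕ} {U : Set (Vec n)} {a : Vec n → Matrix (Fin n) (Fin n) ℝ} {b : Vec n → Vec n}
  {F G : Vec n → Vec n → ℝ} {f φ : ℝ → ℝ} {b₀ : EReal} {x y : Vec n}

/-! Parity in `y`. -/

theorem derivY_neg_of_even (h : ∀ y, F x (-y) = F x y) (l : Fin n) :
    derivY l F x (-y) = -derivY l F x y := by
  have h1 := pderiv_comp_neg l (F x) y
  rw [show (fun z => F x (-z)) = F x from funext h] at h1
  exact (neg_eq_iff_eq_neg.2 h1).symm

theorem derivY_neg_of_odd (h : ∀ y, F x (-y) = -F x y) (l : Fin n) :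
    derivY l F x (-y) = derivY l F x y := by
  have h1 := pderiv_comp_neg l (F x) y
  rw [show (fun z => F x (-z)) = fun z => -F x z from funext h, pderiv_neg] at h1
  exact (neg_injective h1).symm

theorem derivX_neg_of_even (h : ∀ x y, F x (-y) = F x y) (k : Fin n) :
    derivX k F x (-y) = derivX k F x y := by
  simp only [derivX, h]

theorem hamel_neg_of_even (h : ∀ x y, F x (-y) = F x y) : hamel F x (-y) = hamel F x y := by
  ext l
  simp only [hamel, derivX_neg_of_even h, Pi.neg_apply,
    fun k => derivY_neg_of_even (F := derivX k F) (x := x) (y := y)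
      (fun _ => derivX_neg_of_even h k) l, neg_mul_neg]

theorem ratioFlow_neg (a : Vec n → Matrix (Fin n) (Fin n) ℝ) (b : Vec n → Vec n) (x y : Vec n) :
    ratioFlow a b x (-y) = ratioFlow a b x y := by
  have h1 : ∀ k, derivX k (beta b) x (-y) = -derivX k (beta b) x y := fun k => by
    simp only [derivX, beta_neg, pderiv_neg]
  simp only [ratioFlow, flowDeriv, ratio_neg, h1, derivX_neg_of_even (alpha_neg a), Pi.neg_apply,
    mul_neg, neg_mul, Finset.sum_neg_distrib, neg_neg]

theorem gradY_ratio_neg (a : Vec n → Matrix (Fin n) (Fin n) ℝ) (b : Vec n → Vec n)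
    (x y : Vec n) : gradY (ratio a b) x (-y) = gradY (ratio a b) x y :=
  funext fun l => derivY_neg_of_odd (ratio_neg a b x) l

/-! Even and odd parts of functions on a symmetric domain. -/

/-- `(φ(s) + c φ(-s)) / 2`: the even part of `φ` for `c = 1`, the odd part for `c = -1`. -/
noncomputable def reflComb (c : ℝ) (φ : ℝ → ℝ) (s : ℝ) : ℝ := 1 / 2 * (φ s + c * φ (-s))

theorem contDiffOn_reflComb {D : Set ℝ} (hsymm : ∀ s ∈ D, -s ∈ D) (hφ : ContDiffOn ℝ ∞ φ D)
    (c : ℝ) : ContDiffOn ℝ ∞ (reflComb c φ) D :=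
  contDiffOn_const.mul (hφ.add (contDiffOn_const.mul
    (hφ.comp (f := fun s => -s) contDiff_neg.contDiffOn fun s hs => hsymm s hs)))

theorem deriv_reflComb {D : Set ℝ} (hD : IsOpen D) (hsymm : ∀ s ∈ D, -s ∈ D)
    (hφ : ContDiffOn ℝ ∞ φ D) (c : ℝ) {s : ℝ} (hs : s ∈ D) :
    deriv (reflComb c φ) s = 1 / 2 * (deriv φ s - c * deriv φ (-s)) := by
  have hd : ∀ s ∈ D, HasDerivAt φ (deriv φ s) s := fun s hs =>
    ((hφ.contDiffAt (hD.mem_nhds hs)).differentiableAt (by simp)).hasDerivAt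
  have h1 : HasDerivAt (fun s => φ (-s)) (deriv φ (-s) * -1) s :=
    (hd _ (hsymm s hs)).comp s (hasDerivAt_neg s)
  have h2 := ((hd s hs).add (h1.const_mul c)).const_mul (1 / 2)
  refine (h2.congr_deriv ?_).deriv
  ring

theorem deriv_deriv_reflComb {D : Set ℝ} (hD : IsOpen D) (hsymm : ∀ s ∈ D, -s ∈ D)
    (hφ : ContDiffOn ℝ ∞ φ D) (c : ℝ) {s : ℝ} (hs : s ∈ D) :
    deriv (deriv (reflComb c φ)) s =
    1 / 2 * (deriv (deriv φ) s + c * deriv (deriv φ) (-s)) := by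
  have hd : ∀ s ∈ D, HasDerivAt (deriv φ) (deriv (deriv φ) s) s := fun s hs =>
    ((contDiffAt_deriv (hφ.contDiffAt (hD.mem_nhds hs))).differentiableAt (by simp)).hasDerivAt
  have h1 : HasDerivAt (fun s => deriv φ (-s)) (deriv (deriv φ) (-s) * -1) s :=
    (hd _ (hsymm s hs)).comp s (hasDerivAt_neg s)
  have h2 := ((hd s hs).sub (h1.const_mul c)).const_mul (1 / 2)
  have h3 : deriv (reflComb c φ) =ᶠ[nhds s] fun s => 1 / 2 * (deriv φ s - c * deriv φ (-s)) :=
    (hD.eventually_mem hs).mono fun t ht => deriv_reflComb hD hsymm hφ c ht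
  refine ((h2.congr_deriv ?_).congr_of_eventuallyEq h3).deriv
  ring

/-- The domain `(-b₀, b₀)`. -/
def domain (b₀ : EReal) : Set ℝ := {s : ℝ | ((|s| : ℝ) : EReal) < b₀}

theorem isOpen_domain (b₀ : EReal) : IsOpen (domain b₀) :=
  isOpen_Iio.preimage (continuous_coe_real_ereal.comp continuous_abs)

theorem neg_mem_domain {s : ℝ} (hs : s ∈ domain b₀) : -s ∈ domain b₀ := by
  simpa [domain] using hs

/-- The conditions are linear in `φ` and invariant under `s ↦ -s`, so they survive averaging. -/
theorem IsAdmissible.evenPart (hφ : IsAdmissible b₀ φ) : IsAdmissible b₀ (reflComb 1 φ) where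
  pos_bound := hφ.pos_bound
  smooth := contDiffOn_reflComb (D := domain b₀) (fun _ => neg_mem_domain) hφ.smooth 1
  pos s hs := by
    have h1 := hφ.pos s hs
    have h2 := hφ.pos (-s) (neg_mem_domain (s := s) hs)
    rw [reflComb]; linarith
  regular s r hs hr := by
    have hs' : s ∈ domain b₀ := lt_of_le_of_lt (EReal.coe_le_coe_iff.2 hs) hr
    have h1 := hφ.regular s r hs hr
    have h2 := hφ.regular (-s) r (by rwa [abs_neg]) hr
    rw [deriv_reflComb (isOpen_domain b₀) (fun _ => neg_mem_domain) hφ.smooth 1 hs',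
      deriv_deriv_reflComb (isOpen_domain b₀) (fun _ => neg_mem_domain) hφ.smooth 1 hs', reflComb]
    rw [neg_sq] at h2
    linarith

theorem IsAlphaBetaData.mem_domain (h : IsAlphaBetaData U a b b₀ φ F) (hx : x ∈ U) {s : ℝ}
    (hs : s ^ 2 ≤ normSq a b x) : s ∈ domain b₀ :=
  lt_of_le_of_lt (EReal.coe_le_coe_iff.2 (Real.abs_le_sqrt hs)) (h.norm_lt x hx)

theorem IsAlphaBetaData.ratio_mem_domain (h : IsAlphaBetaData U a b b₀ φ F) {x y : Vec n}
    (hxy : (x, y) ∈ slit U) : ratio a b x y ∈ domain b₀ :=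
  h.mem_domain hxy.1 (ratio_sq_le h.riemannian hxy.1 hxy.2)

/-- The Hamel equations of `α φ(β / α)` split into those of the even and of the odd part of `φ`. -/
theorem hamel_reflComb (hU : IsOpen U) (h : IsAlphaBetaData U a b b₀ φ F)
    (hF : ∀ x ∈ U, ∀ y, y ≠ 0 → hamel F x y = 0) (c : ℝ) (hx : x ∈ U)
    (hy : y ≠ 0) : hamel (alphaBeta a b (reflComb c φ)) x y = 0 := by
  have hsymm : ∀ s ∈ domain b₀, -s ∈ domain b₀ := fun _ => neg_mem_domain
  have hmem := h.ratio_mem_domain (mk_mem_slit hx hy)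
  have key : ∀ y, y ≠ 0 → hamel (alphaBeta a b φ) x y = 0 := fun y hy => by
    rw [← hF x hx y hy]
    exact hamel_congr (isOpen_slit hU) (fun x y hxy => (h.eq x hxy.1 y).symm) (mk_mem_slit hx hy)
  have e1 := key y hy
  have e2 := key (-y) (neg_ne_zero.2 hy)
  rw [hamel_alphaBeta hU h.riemannian h.oneForm (isOpen_domain b₀) h.admissible.smooth
    (fun _ _ => h.ratio_mem_domain) hx hy] at e1
  rw [hamel_alphaBeta hU h.riemannian h.oneForm (isOpen_domain b₀) h.admissible.smooth
    (fun _ _ => h.ratio_mem_domain) hx (neg_ne_zero.2 hy), hamel_neg_of_even (alpha_neg a),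
    ratioFlow_neg, gradY_ratio_neg, ratio_neg, Matrix.mulVec_neg] at e2
  rw [hamel_alphaBeta hU h.riemannian h.oneForm (isOpen_domain b₀)
    (contDiffOn_reflComb hsymm h.admissible.smooth c) (fun _ _ => h.ratio_mem_domain) hx hy,
    deriv_reflComb (isOpen_domain b₀) hsymm h.admissible.smooth c hmem,
    deriv_deriv_reflComb (isOpen_domain b₀) hsymm h.admissible.smooth c hmem]
  ext l
  have e1' := congrFun e1 l
  have e2' := congrFun e2 l
  simp only [Pi.add_apply, Pi.smul_apply, Pi.neg_apply, smul_eq_mul, Pi.zero_apply] at e1' e2' ⊢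
  rw [reflComb]
  -- Under `y ↦ -y` only the curl term changes sign, as does the first derivative of `φ(-s)`; hence
  -- the same combination of the two equations works for all three terms.
  linear_combination 1 / 2 * e1' + c / 2 * e2'

/-! Rigidity on `U`. -/

/-- The polynomial in `y` that `α²` times `ratioFlow` turns out to be in `rigidity`. -/
theorem analyticOnNhd_polynomial (A B : Matrix (Fin n) (Fin n) ℝ) (p : Vec n)
    (C : Fin n → Matrix (Fin n) (Fin n) ℝ) :
    AnalyticOnNhd ℝ (fun y : Vec n => (y ⬝ᵥ A *ᵥ y) * (∑ k, (B *ᵥ y) k * y k) -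
      (p ⬝ᵥ y) * (1 / 2 * ∑ k, (y ⬝ᵥ C k *ᵥ y) * y k)) Set.univ := by
  rw [← contDiff_omega_iff_analyticOnNhd]
  simp only [dotProduct, Matrix.mulVec]
  fun_prop

theorem reflComb_neg_one_zero (φ : ℝ → ℝ) : reflComb (-1) φ 0 = 0 := by
  simp [reflComb]

theorem rigidity (hn : 3 ≤ n) (hU : IsOpen U) (h : IsAlphaBetaData U a b b₀ φ F)
    (hF : ∀ x ∈ U, ∀ y, y ≠ 0 → hamel F x y = 0) (hx : x ∈ U) {r : ℝ} (hr : 0 < r)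
    (hrB : r ^ 2 < normSq a b x) (hne : reflComb (-1) φ r ≠ deriv (reflComb (-1) φ) 0 * r) :
    curl b x = 0 ∧ ∀ y, y ≠ 0 → ratioFlow a b x y = 0 ∧ hamel (alpha a) x y = 0 := by
  have ha := h.riemannian
  have hb := h.oneForm
  have hsymm : ∀ s ∈ domain b₀, -s ∈ domain b₀ := fun _ => neg_mem_domain
  have hsm := fun c => contDiffOn_reflComb hsymm h.admissible.smooth c
  have heven := h.admissible.evenPart
  have hαsq : ∀ y, √(y ⬝ᵥ a x *ᵥ y) = alpha a x y := fun y => rfl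
  have hcomb : ∀ c : ℝ, ∀ y, y ≠ 0 →
      (reflComb c φ (ratio a b x y) - ratio a b x y * deriv (reflComb c φ) (ratio a b x y)) •
        hamel (alpha a) x y + deriv (reflComb c φ) (ratio a b x y) • curl b x *ᵥ y +
      (deriv (deriv (reflComb c φ)) (ratio a b x y) * ratioFlow a b x y) •
        gradY (ratio a b) x y = 0 := fun c y hy => by
    rw [← hamel_alphaBeta hU ha hb (isOpen_domain b₀) (hsm c) (fun _ _ => h.ratio_mem_domain) hx hy]
    exact hamel_reflComb hU h hF c hx hy
  -- Multiplying `ratioFlow` by `α²` clears all roots: `α` times the flow derivative of `α` is half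
  -- that of the quadratic form `α²`, which yields the polynomial `Q`.
  refine coefficients_eq_zero hn (ha.2 x hx) (mulVec_dual (b := b) ha hx) (M := curl b x)
    (A := hamel (alpha a) x) (S := gradY (ratio a b) x) (T := ratioFlow a b x)
    (Q := fun y => (y ⬝ᵥ a x *ᵥ y) *
        (∑ k, (Matrix.of (fun k i => pderiv k (fun z => b z i) x) *ᵥ y) k * y k) -
      (b x ⬝ᵥ y) * (1 / 2 * ∑ k, (y ⬝ᵥ matDeriv k a x *ᵥ y) * y k))
    (σ := ratio a b x) (g := reflComb 1 φ) (h := reflComb (-1) φ)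
    ?_ (fun y => rfl) ?_ (analyticOnNhd_polynomial _ _ _ _) ?_ ?_ ?_ ?_ ?_ ?_
    (reflComb_neg_one_zero φ) hr hrB hne (hcomb 1) (hcomb (-1))
  · ext i j
    simp [curl]
  · intro y hy
    rw [hαsq]
    ext l
    have := alpha_mul_gradY_ratio hU ha hb hx hy l
    rw [derivY_alpha hU ha hx hy] at this
    simp only [Pi.smul_apply, Pi.sub_apply, smul_eq_mul, gradY]
    rw [this]; ring
  · intro y hy
    have h1 : ∑ k, (Matrix.of (fun k i => pderiv k (fun z => b z i) x) *ᵥ y) k * y k =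
        flowDeriv (beta b) x y := by
      simp only [flowDeriv, derivX_beta hU hb hx, Matrix.mulVec, dotProduct, Matrix.of_apply]
    have h2 : 1 / 2 * ∑ k, (y ⬝ᵥ matDeriv k a x *ᵥ y) * y k =
        alpha a x y * flowDeriv (alpha a) x y := by
      simp only [flowDeriv, derivX_alpha hU ha hx hy, derivX_quad hU ha hx, Finset.mul_sum]
      refine Finset.sum_congr rfl fun k _ => ?_
      have := (alpha_pos ha hx hy).ne'
      rw [quad]
      field_simp
    have h3 : y ⬝ᵥ a x *ᵥ y = alpha a x y ^ 2 := (sqr_alpha ha hx y).symm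
    have h4 : b x ⬝ᵥ y = ratio a b x y * alpha a x y := (ratio_mul_alpha ha hx hy).symm
    rw [h1, h2, h3, h4, ratioFlow]
    ring
  · exact fun y hy => ratio_sq_le ha hx hy
  · exact fun s hs => (hsm 1).contDiffAt ((isOpen_domain b₀).mem_nhds (h.mem_domain hx hs))
  · exact fun s hs => (hsm (-1)).contDiffAt ((isOpen_domain b₀).mem_nhds (h.mem_domain hx hs))
  · exact fun s hs => heven.pos s (h.mem_domain hx hs)
  · intro s hs
    have := heven.regular s |s| le_rfl (h.mem_domain hx hs)
    rwa [sq_abs, sub_self, zero_mul, add_zero] at this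

theorem IsRiemannianMetric.mono {V : Set (Vec n)} (ha : IsRiemannianMetric U a) (hV : V ⊆ U) :
    IsRiemannianMetric V a :=
  ⟨fun i j => (ha.1 i j).mono hV, fun x hx => ha.2 x (hV hx)⟩

/-- If `β` is parallel wherever `‖β‖ > r`, and `‖β‖ > r` at `x`, then `‖β‖` is constant on the
connected component of `x`. -/
theorem normSq_eq_on_component (hU : IsOpen U) (ha : IsRiemannianMetric U a)
    (hb : IsOneForm U b) (hx : x ∈ U)
    {r : ℝ} (hrx : r ^ 2 < normSq a b x)
    (hr : ∀ z ∈ U, r ^ 2 < normSq a b z → ∀ i j, covDeriv a b i j z = 0) :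
    ∀ z ∈ connectedComponentIn U x, normSq a b z = normSq a b x := by
  set C := connectedComponentIn U x
  have hCU : C ⊆ U := connectedComponentIn_subset U x
  have hcont : ContinuousOn (normSq a b) U := fun z hz =>
    (differentiableAt_normSq hU ha hb hz).continuousAt.continuousWithinAt
  set V := U ∩ normSq a b ⁻¹' Set.Ioi (r ^ 2)
  have hV : IsOpen V := hcont.isOpen_inter_preimage hU isOpen_Ioi
  have hloc : ∀ z ∈ V, ∀ᶠ w in nhds z, normSq a b w = normSq a b z := by
    intro z hz
    obtain ⟨ε, hε, hball⟩ := Metric.isOpen_iff.1 hV z hz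
    filter_upwards [Metric.ball_mem_nhds z hε] with w hw
    refine Metric.isOpen_ball.is_const_of_fderiv_eq_zero
      (convex_ball z ε).isPreconnected (fun t ht => (differentiableAt_normSq hU ha hb
        (hball ht).1).differentiableWithinAt) (fun t ht => ?_) hw (Metric.mem_ball_self hε)
    exact fderiv_normSq_eq_zero hU ha hb (hball ht).1 (hr t (hball ht).1 (hball ht).2)
  have hxV : x ∈ V := ⟨hx, hrx⟩
  have hopen : IsOpen {z ∈ V | normSq a b z = normSq a b x} := by
    rw [isOpen_iff_mem_nhds]
    rintro z ⟨hz, hzx⟩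
    filter_upwards [hV.mem_nhds hz, hloc z hz] with w hw hwz
    exact ⟨hw, hwz.trans hzx⟩
  have hopen' : IsOpen (U ∩ normSq a b ⁻¹' {normSq a b x}ᶜ) :=
    hcont.isOpen_inter_preimage hU isOpen_compl_singleton
  -- The level set is open since the norm is locally constant on `V`, and its complement is open by
  -- continuity. A connected set meeting the first stays inside it.
  have hsub : C ⊆ {z ∈ V | normSq a b z = normSq a b x} := by
    refine isPreconnected_connectedComponentIn.subset_left_of_subset_union hopen hopen' ?_ ?_
      ⟨x, mem_connectedComponentIn hx, hxV, rfl⟩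
    · exact Set.disjoint_left.2 fun z h1 h2 => h2.2 h1.2
    · intro z hz
      by_cases hzx : normSq a b z = normSq a b x
      · exact Or.inl ⟨⟨hCU hz, by simpa [hzx] using hrx⟩, hzx⟩
      · exact Or.inr ⟨hCU hz, hzx⟩
  exact fun z hz => (hsub hz).2

/-- For a non-trivial projectively flat `(α, β)`-metric, the odd part of `φ` is linear on the range
of `β / α`. -/
theorem oddPart_eq (hn : 3 ≤ n) (hU : IsOpen U) (h : IsAlphaBetaData U a b b₀ φ F)
    (hF : ∀ x ∈ U, ∀ y, y ≠ 0 → hamel F x y = 0) (hnt : IsNontrivialPair U a b) (hx : x ∈ U)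
    {s : ℝ} (hs : s ^ 2 ≤ normSq a b x) :
    reflComb (-1) φ s = deriv (reflComb (-1) φ) 0 * s := by
  have : NeZero n := ⟨by omega⟩
  have ha := h.riemannian
  have hb := h.oneForm
  -- A failure of linearity at `r` does not refer to the base point, so `rigidity` applies at every
  -- point where `‖β‖ > r`, in particular on the whole component of `x`.
  have hint : ∀ r : ℝ, 0 < r → r ^ 2 < normSq a b x →
      reflComb (-1) φ r = deriv (reflComb (-1) φ) 0 * r := by
    intro r hr hrB
    by_contra hne
    have hrig := fun z (hz : z ∈ U) hzB => rigidity hn hU h hF (x := z) hz hr hzB hne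
    have hpar : ∀ z ∈ U, r ^ 2 < normSq a b z → ∀ i j, covDeriv a b i j z = 0 :=
      fun z hz hzB => covDeriv_eq_zero hU ha hb hz (hrig z hz hzB).1 (hrig z hz hzB).2
    have hconst := normSq_eq_on_component hU ha hb hx hrB hpar
    have hC : connectedComponentIn U x ⊆ U := connectedComponentIn_subset U x
    have hCB : ∀ z ∈ connectedComponentIn U x, r ^ 2 < normSq a b z := fun z hz => by
      rwa [hconst z hz]
    refine hnt x hx ⟨?_, fun z hz => hpar z (hC hz) (hCB z hz)⟩
    exact isProjectivelyFlat_of_hamel hU.connectedComponentIn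
      (isFinslerMetric_alpha hU.connectedComponentIn (ha.mono hC))
      fun z hz y hy => ((hrig z (hC hz) (hCB z hz)).2 y hy).2
  -- The endpoint `r = ‖β‖` follows by continuity from smaller values; negative arguments follow by
  -- oddness.
  have hpos : ∀ r : ℝ, 0 < r → r ^ 2 ≤ normSq a b x →
      reflComb (-1) φ r = deriv (reflComb (-1) φ) 0 * r := by
    intro r hr hrB
    by_contra hne
    have hc : ContinuousAt (reflComb (-1) φ) r :=
      ((contDiffOn_reflComb (D := domain b₀) (fun _ => neg_mem_domain) h.admissible.smooth
        (-1)).contDiffAt ((isOpen_domain b₀).mem_nhds (h.mem_domain hx hrB))).continuousAt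
    have hev : ∀ᶠ t in nhds r, reflComb (-1) φ t - deriv (reflComb (-1) φ) 0 * t ≠ 0 :=
      (hc.sub (continuousAt_const.mul continuousAt_id)).eventually_ne (sub_ne_zero.2 hne)
    obtain ⟨t, ht, ht'⟩ := ((hev.filter_mono nhdsWithin_le_nhds).and
      (Ioo_mem_nhdsLT hr)).exists
    exact ht (sub_eq_zero.2 (hint t ht'.1
      (lt_of_lt_of_le (pow_lt_pow_left₀ ht'.2 ht'.1.le two_ne_zero) hrB)))
  rcases lt_trichotomy s 0 with hs0 | rfl | hs0
  · have h1 := hpos (-s) (neg_pos.2 hs0) (by rwa [neg_sq])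
    simp only [reflComb, neg_neg] at h1 ⊢
    linear_combination -h1
  · rw [reflComb_neg_one_zero, mul_zero]
  · exact hpos s hs0 hs

theorem deriv_oddPart_zero (h : IsAlphaBetaData U a b b₀ φ F) :
    deriv (reflComb (-1) φ) 0 = deriv φ 0 := by
  rw [deriv_reflComb (isOpen_domain b₀) (fun _ => neg_mem_domain) h.admissible.smooth (-1)
    (show (0 : ℝ) ∈ domain b₀ by simpa [domain] using h.admissible.pos_bound), neg_zero]
  ring

/-! The metric `F + θ`. -/

theorem IsFinslerMetric.congr (hU : IsOpen U) (hF : IsFinslerMetric U F)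
    (h : ∀ x ∈ U, ∀ y, G x y = F x y) : IsFinslerMetric U G where
  continuousOn := hF.continuousOn.congr fun p hp => h p.1 hp.1 p.2
  nonneg x hx y := by rw [h x hx]; exact hF.nonneg x hx y
  smooth := hF.smooth.congr fun p hp => h p.1 hp.1 p.2
  homogeneous x hx y c hc := by rw [h x hx, h x hx]; exact hF.homogeneous x hx y c hc
  stronglyConvex x hx y hy := by
    rw [fundTensor_congr (isOpen_slit hU) (fun x y hxy => h x hxy.1 y) (mk_mem_slit hx hy)]
    exact hF.stronglyConvex x hx y hy

theorem hamel_sub {W : Set (Vec n × Vec n)} (hW : IsOpen W) (hF : SmoothOn W F)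
    (hG : SmoothOn W G) (hxy : (x, y) ∈ W) :
    hamel (fun x y => F x y - G x y) x y = hamel F x y - hamel G x y := by
  have h1 : ∀ k x y, (x, y) ∈ W →
      derivX k (fun x y => F x y - G x y) x y = derivX k F x y - derivX k G x y :=
    fun k x y h => pderiv_sub (hF.differentiableAt_left hW h) (hG.differentiableAt_left hW h)
  have h2 : ∀ k l, derivY l (derivX k (fun x y => F x y - G x y)) x y =
      derivY l (derivX k F) x y - derivY l (derivX k G) x y := fun k l => by
    rw [derivY_congr hW (G := fun x y => derivX k F x y - derivX k G x y)
      (fun x y h => h1 k x y h) l hxy]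
    exact pderiv_sub ((hF.derivX hW k).differentiableAt_right hW hxy)
      ((hG.derivX hW k).differentiableAt_right hW hxy)
  ext l
  simp only [hamel, h2, h1 l x y hxy, Pi.sub_apply, sub_mul, Finset.sum_sub_distrib]
  ring

theorem alphaBeta_isReversible (U : Set (Vec n)) (a : Vec n → Matrix (Fin n) (Fin n) ℝ)
    (b : Vec n → Vec n) (hf : ∀ s, f (-s) = f s) : IsReversible U (alphaBeta a b f) := by
  intro x _ y c
  rw [alphaBeta, alphaBeta, alpha_smul, beta_smul, mul_assoc]
  rcases lt_trichotomy c 0 with hc | rfl | hc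
  · have : c * beta b x y / (-c * alpha a x y) = -(beta b x y / alpha a x y) := by
      rw [neg_mul, div_neg, mul_div_mul_left _ _ hc.ne]
    rw [abs_of_neg hc, this, hf]
  · simp
  · rw [abs_of_pos hc, mul_div_mul_left _ _ hc.ne']

end Finsler

/-! ### The main theorem. -/

open Finsler in
theorem theorem7p1 {n : ℕ} (hn : 3 ≤ n) (U : Set (Finsler.Vec n)) (hU : IsOpen U)
    (a : Finsler.Vec n → Matrix (Fin n) (Fin n) ℝ) (b : Finsler.Vec n → Finsler.Vec n)
    (b₀ : EReal) (φ : ℝ → ℝ) (F : Finsler.Vec n → Finsler.Vec n → ℝ)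
    (hF : Finsler.IsAlphaBetaData U a b b₀ φ F)
    (hflat : Finsler.IsProjectivelyFlat U F)
    (hnontrivial : Finsler.IsNontrivialPair U a b) :
    ∃ θ : Finsler.Vec n → Finsler.Vec n,
      (∀ x ∈ U, θ x = -deriv φ 0 • b x) ∧
      Finsler.IsOneForm U θ ∧
      Finsler.IsClosedForm U θ ∧
      Finsler.IsAlphaBetaMetric U (fun x y => F x y + Finsler.beta θ x y) ∧
      Finsler.IsReversible U (fun x y => F x y + Finsler.beta θ x y) ∧
      Finsler.IsProjectivelyFlat U (fun x y => F x y + Finsler.beta θ x y) := by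
  have : NeZero n := ⟨by omega⟩
  have ha := hF.riemannian
  have hham : ∀ x ∈ U, ∀ y, y ≠ 0 → hamel F x y = 0 := fun x hx y hy =>
    hamel_eq_zero_of_isProjectivelyFlat hU hF.finsler hflat hx hy
  set θ : Vec n → Vec n := fun x => -deriv φ 0 • b x with hθ
  have hθform : IsOneForm U θ := fun i => contDiffOn_const.mul (hF.oneForm i)
  have hsum : ∀ x ∈ U, ∀ y, F x y + beta θ x y = alphaBeta a b (reflComb 1 φ) x y := by
    intro x hx y
    have hβ : beta θ x y = -deriv φ 0 * beta b x y := by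
      rw [beta, beta, hθ, smul_dotProduct, smul_eq_mul]
    rw [hF.eq x hx, hβ]
    by_cases hy : y = 0
    · simp [hy, alphaBeta, alpha, beta]
    have h1 := oddPart_eq hn hU hF hham hnontrivial hx (ratio_sq_le ha hx hy)
    rw [deriv_oddPart_zero hF] at h1
    have h2 := ratio_mul_alpha (b := b) ha hx hy
    change alpha a x y * φ (ratio a b x y) + _ = alpha a x y * reflComb 1 φ (ratio a b x y)
    simp only [reflComb] at h1 ⊢
    linear_combination alpha a x y * h1 + deriv φ 0 * h2
  -- Evenness of `F + θ` in `y` and oddness of `θ` identify the sum with the average of `F` over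
  -- `±y`, whose strong convexity is already available.
  have hsymm : ∀ x ∈ U, ∀ y, F x y + beta θ x y = symmetrization F x y := by
    intro x hx y
    have h1 := hsum x hx (-y)
    have h2 := hsum x hx y
    have h3 : alphaBeta a b (reflComb 1 φ) x (-y) = alphaBeta a b (reflComb 1 φ) x y := by
      have := alphaBeta_isReversible U a b (f := reflComb 1 φ)
        (fun s => by simp only [reflComb, neg_neg]; ring) x hx y (-1)
      simpa using this
    rw [beta_neg, h3] at h1
    rw [symmetrization]
    linarith
  have hfin : IsFinslerMetric U fun x y => F x y + beta θ x y :=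
    (hF.finsler.symmetrization hU).congr hU hsymm
  have hham' : ∀ x ∈ U, ∀ y, y ≠ 0 → hamel (fun x y => F x y + beta θ x y) x y = 0 := by
    intro x hx y hy
    rw [hamel_congr (isOpen_slit hU) (fun x y h => hsum x h.1 y) (mk_mem_slit hx hy)]
    exact hamel_reflComb hU hF hham 1 hx hy
  refine ⟨θ, fun _ _ => rfl, hθform, isClosedForm_iff_curl.2 fun x hx => ?_,
    ⟨a, b, b₀, reflComb 1 φ, ?_⟩, ?_, isProjectivelyFlat_of_hamel hU hfin hham'⟩
  -- By linearity the Hamel vector of `θ = (F + θ) - F` is zero, and for a 1-form this vector is the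
  -- curl applied to `y`.
  · have h1 : ∀ y, y ≠ 0 → curl θ x *ᵥ y = 0 := by
      intro y hy
      rw [← hamel_beta hU hθform hx,
        show beta θ = fun x y => (F x y + beta θ x y) - F x y by ext; ring,
        hamel_sub (isOpen_slit hU) hfin.smoothOn hF.finsler.smoothOn (mk_mem_slit hx hy),
        hham' x hx y hy, hham x hx y hy, sub_zero]
    ext i j
    have := congrFun (h1 (Pi.single j 1) fun h => by simpa using congrFun h j) i
    simpa using this
  · exact
      { riemannian := ha
        oneForm := hF.oneForm
        admissible := hF.admissible.evenPart
        norm_lt := hF.norm_lt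
        eq := hsum
        finsler := hfin }
  · intro x hx y c
    simp only [hsum x hx]
    exact alphaBeta_isReversible U a b
      (fun s => by simp only [reflComb, neg_neg]; ring) x hx y c
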